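/- Let $c>0$. On $L^2[-1,1]$ (complex valued functions) let $\mathcal F_c[\phi](x)=\int_{-1}^{1}e^{icxt}\phi(t)\,dt$ be the finite Fourier transform and $\mathcal R[\phi](x)=\phi(-x)$ the reflection. Let $$T_x=(1-x^2)\frac{d^2}{dx^2}-2x\frac{d}{dx}-c^2x^2 ,$$ acting on $C^\infty([-1,1])$, and let the polynomials $U_k$ be given by $U_0=1$ and, for $k\ge 0$, $$U_{k+1}(T)=\frac{T+c^2+k(k+1)}{2(k+1)}\,U_k(T)-\frac{c^2k}{k+1}\,U_{k-1}(T)+\frac{c^2k(k-1)}{2(k+1)}\,U_{k-2}(T)$$ (the terms with a negative index have coefficient $0$). For real $\xi$ let $$U(\xi;T_x)\phi=\sum_{k=0}^\infty\frac{\xi^k}{k!}\,U_k(T_x)\phi ,$$ with domain the set of those $\phi\in C^\infty([-1,1])$ for which the series converges in $L^2[-1,1]$. Then for every $\xi\in[0,1]$ the operator $U(\xi;T_x)$ is closable, and its closure, again written $U(\xi;T_x)$, is a bounded operator defined on all of $L^2[-1,1]$. Moreover $$\mathcal F_c=\int_0^1\left(e^{ic(1-\xi)}+\mathcal R\,e^{-ic(1-\xi)}\right)U(\xi;T_x)\,d\xi$$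 as operators on $L^2[-1,1]$: for every $f\in L^2[-1,1]$ the function $\xi\mapsto\left(e^{ic(1-\xi)}+\mathcal R\,e^{-ic(1-\xi)}\right)U(\xi;T_x)f$ is Bochner integrable on $[0,1]$ and its integral is $\mathcal F_c f$. (Only $\xi\in[0,1]$ is used.) -/

import Mathlib

open MeasureTheory Set Filter Topology
open scoped ContDiff

namespace TimeBand

noncomputable section

/-- Lebesgue measure on `[-1,1]`. -/
abbrev vol : Measure ℝ := volume.restrict (Icc (-1 : ℝ) 1)

/-- The complex Hilbert space `L²[-1,1]`. -/
abbrev L2 : Type := Lp ℂ 2 vol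

/-! ### The finite Fourier transform and the reflection -/

/-- The function `x ↦ ∫_{-1}^{1} e^{icxt} φ(t) dt`. -/
def fourierFun (c : ℝ) (φ : ℝ → ℂ) (x : ℝ) : ℂ :=
  ∫ t in Icc (-1 : ℝ) 1, Complex.exp (Complex.I * c * x * t) * φ t

theorem norm_exp_kernel (c x t : ℝ) : ‖Complex.exp (Complex.I * c * x * t)‖ = 1 := by
  have : Complex.I * c * x * t = ((c * x * t : ℝ) : ℂ) * Complex.I := by push_cast; ring
  rw [this, Complex.norm_exp_ofReal_mul_I]

theorem integrable_kernel (c x : ℝ) {φ : ℝ → ℂ} (hφ : Integrable φ vol) :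
    Integrable (fun t : ℝ => Complex.exp (Complex.I * c * x * t) * φ t) vol := by
  refine hφ.bdd_mul (c := 1) ?_ ?_
  · exact (by fun_prop : Continuous fun t : ℝ =>
      Complex.exp (Complex.I * c * x * t)).aestronglyMeasurable
  · exact Eventually.of_forall fun t => (norm_exp_kernel c x t).le

theorem integrable_L2 (f : L2) : Integrable f vol :=
  (Lp.memLp f).integrable (by norm_num)

theorem continuous_fourierFun (c : ℝ) {φ : ℝ → ℂ} (hφ : Integrable φ vol) :
    Continuous (fourierFun c φ) := by
  refine continuous_of_dominated (bound := fun t => ‖φ t‖) ?_ ?_ hφ.norm ?_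
  · exact fun x => (integrable_kernel c x hφ).aestronglyMeasurable
  · exact fun x => Eventually.of_forall fun t => by
      rw [norm_mul, norm_exp_kernel, one_mul]
  · exact Eventually.of_forall fun t => by fun_prop

/-- A continuous function restricts to an element of `L²[-1,1]`. -/
theorem memLp_of_continuous {φ : ℝ → ℂ} (hφ : Continuous φ) : MemLp φ 2 vol := by
  obtain ⟨C, hC⟩ := (isCompact_Icc (a := (-1 : ℝ)) (b := 1)).exists_bound_of_continuousOn
    hφ.continuousOn
  exact MemLp.of_bound hφ.aestronglyMeasurable C
    ((ae_restrict_iff' measurableSet_Icc).2 (Eventually.of_forall hC))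

/-- The finite Fourier transform `F_c[φ](x) = ∫_{-1}^{1} e^{icxt} φ(t) dt` on `L²[-1,1]`. -/
def finiteFourier (c : ℝ) : L2 →ₗ[ℂ] L2 where
  toFun f := (memLp_of_continuous (continuous_fourierFun c (integrable_L2 f))).toLp
  map_add' f g := by
    rw [← MemLp.toLp_add]
    refine (MemLp.toLp_eq_toLp_iff _ _).2 (Eventually.of_forall fun x => ?_)
    simp only [fourierFun, Pi.add_apply]
    rw [← integral_add (integrable_kernel c x (integrable_L2 f))
      (integrable_kernel c x (integrable_L2 g))]
    refine integral_congr_ae ?_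
    filter_upwards [Lp.coeFn_add f g] with t ht
    rw [ht, Pi.add_apply, mul_add]
  map_smul' a f := by
    rw [RingHom.id_apply, ← MemLp.toLp_const_smul]
    refine (MemLp.toLp_eq_toLp_iff _ _).2 (Eventually.of_forall fun x => ?_)
    simp only [fourierFun, Pi.smul_apply]
    rw [← integral_smul]
    refine integral_congr_ae ?_
    filter_upwards [Lp.coeFn_smul a f] with t ht
    rw [ht, Pi.smul_apply, smul_eq_mul, smul_eq_mul]
    ring

theorem measurePreserving_neg : MeasurePreserving (fun x : ℝ => -x) vol vol := by
  have h := (Measure.measurePreserving_neg (volume : Measure ℝ)).restrict_preimage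
    (measurableSet_Icc (a := (-1 : ℝ)) (b := 1))
  have h' : (Neg.neg : ℝ → ℝ) ⁻¹' Icc (-1 : ℝ) 1 = Icc (-1 : ℝ) 1 := by simp
  rw [h'] at h
  exact h

/-- The reflection `R[φ](x) = φ(-x)` on `L²[-1,1]`. -/
def reflection : L2 →L[ℂ] L2 :=
  (Lp.compMeasurePreservingₗᵢ ℂ (fun x : ℝ => -x) measurePreserving_neg).toContinuousLinearMap

/-! ### The Heun operator and its functions -/

/-- Smooth complex functions of a real variable. -/
def Smooth : Submodule ℂ (ℝ → ℂ) where
  carrier := {φ | ContDiff ℝ ∞ φ}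
  add_mem' hf hg := Set.mem_ofPred.2 ((Set.mem_ofPred.1 hf).add (Set.mem_ofPred.1 hg))
  zero_mem' := Set.mem_ofPred.2 contDiff_const
  smul_mem' a _ hf := Set.mem_ofPred.2 ((Set.mem_ofPred.1 hf).const_smul a)

theorem contDiff_of_smooth (φ : Smooth) : ContDiff ℝ ∞ (φ : ℝ → ℂ) := Set.mem_ofPred.1 φ.2

theorem contDiff_deriv {φ : ℝ → ℂ} (h : ContDiff ℝ ∞ φ) : ContDiff ℝ ∞ (deriv φ) :=
  (contDiff_infty_iff_deriv.1 h).2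

theorem smooth_diff (φ : Smooth) : Differentiable ℝ (φ : ℝ → ℂ) :=
  (contDiff_infty_iff_deriv.1 (contDiff_of_smooth φ)).1

theorem smooth_diff_deriv (φ : Smooth) : Differentiable ℝ (deriv (φ : ℝ → ℂ)) :=
  (contDiff_infty_iff_deriv.1 (contDiff_deriv (contDiff_of_smooth φ))).1

/-- The Heun operator `T = (1 - x²) d²/dx² - 2x d/dx - c² x²` on smooth functions. -/
def heunT (c : ℝ) : Module.End ℂ Smooth where
  toFun φ := ⟨fun x => (1 - (x : ℂ) ^ 2) * deriv (deriv (φ : ℝ → ℂ)) x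
      - 2 * (x : ℂ) * deriv (φ : ℝ → ℂ) x - (c : ℂ) ^ 2 * (x : ℂ) ^ 2 * (φ : ℝ → ℂ) x, by
    have h0 : ContDiff ℝ ∞ (φ : ℝ → ℂ) := contDiff_of_smooth φ
    have h1 := contDiff_deriv h0
    have h2 := contDiff_deriv h1
    have hx : ContDiff ℝ ∞ (fun x : ℝ => (x : ℂ)) := Complex.ofRealCLM.contDiff
    refine Set.mem_ofPred.2 ?_
    exact (((contDiff_const.sub (hx.pow 2)).mul h2).sub ((contDiff_const.mul hx).mul h1)).sub
      ((contDiff_const.mul (hx.pow 2)).mul h0)⟩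
  map_add' φ ψ := by
    have e1 : deriv ((φ : ℝ → ℂ) + (ψ : ℝ → ℂ)) = deriv (φ : ℝ → ℂ) + deriv (ψ : ℝ → ℂ) :=
      funext fun x => deriv_add (smooth_diff φ x) (smooth_diff ψ x)
    have e2 : deriv (deriv (φ : ℝ → ℂ) + deriv (ψ : ℝ → ℂ))
        = deriv (deriv (φ : ℝ → ℂ)) + deriv (deriv (ψ : ℝ → ℂ)) :=
      funext fun x => deriv_add (smooth_diff_deriv φ x) (smooth_diff_deriv ψ x)
    ext x
    simp only [Submodule.coe_add, Pi.add_apply, e1, e2]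
    ring
  map_smul' a φ := by
    have e1 : deriv (a • (φ : ℝ → ℂ)) = a • deriv (φ : ℝ → ℂ) :=
      funext fun x => deriv_const_smul a (smooth_diff φ x)
    have e2 : deriv (a • deriv (φ : ℝ → ℂ)) = a • deriv (deriv (φ : ℝ → ℂ)) :=
      funext fun x => deriv_const_smul a (smooth_diff_deriv φ x)
    ext x
    simp only [Submodule.coe_smul, Pi.smul_apply, e1, e2, smul_eq_mul, RingHom.id_apply]
    ring

/-- The polynomials `U_k`: `U_0 = 1` and
`U_{k+1}(T) = (T + c² + k(k+1)) / (2(k+1)) U_k(T) - c² k / (k+1) U_{k-1}(T)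
  + c² k (k-1) / (2(k+1)) U_{k-2}(T)`.
For `k ≤ 1` the terms with a negative index carry the coefficient `0`. -/
def heunPoly (c : ℝ) : ℕ → Polynomial ℂ
  | 0 => 1
  | k + 1 =>
      Polynomial.C (1 / (2 * ((k : ℂ) + 1)))
          * (Polynomial.X + Polynomial.C ((c : ℂ) ^ 2 + (k : ℂ) * ((k : ℂ) + 1))) * heunPoly c k
        - Polynomial.C ((c : ℂ) ^ 2 * (k : ℂ) / ((k : ℂ) + 1)) * heunPoly c (k - 1)
        + Polynomial.C ((c : ℂ) ^ 2 * (k : ℂ) * ((k : ℂ) - 1) / (2 * ((k : ℂ) + 1)))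
          * heunPoly c (k - 2)

/-- The class in `L²[-1,1]` of the restriction of a smooth function to `[-1,1]`. -/
def toL2 : Smooth →ₗ[ℂ] L2 where
  toFun φ := (memLp_of_continuous (contDiff_of_smooth φ).continuous).toLp
  map_add' _ _ := rfl
  map_smul' _ _ := rfl

/-- The partial sums of `∑ ξ^k / k! U_k(T) φ`, as elements of `L²[-1,1]`. -/
def heunPartialSum (c ξ : ℝ) (N : ℕ) : Smooth →ₗ[ℂ] L2 :=
  ∑ k ∈ Finset.range N,
    ((ξ : ℂ) ^ k / (k.factorial : ℂ)) • (toL2 ∘ₗ Polynomial.aeval (heunT c) (heunPoly c k))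

/-- The graph of `U(ξ; T)`: pairs `(f, g)` such that `f` is (the class of) a smooth function `φ` on
`[-1,1]` and the series `∑ ξ^k / k! U_k(T) φ` converges to `g` in `L²[-1,1]`. -/
def heunUGraph (c ξ : ℝ) : Submodule ℂ (L2 × L2) where
  carrier := {p | ∃ φ : Smooth, toL2 φ = p.1 ∧
    Tendsto (fun N => heunPartialSum c ξ N φ) atTop (𝓝 p.2)}
  add_mem' := by
    rintro p q ⟨φ, h1, h2⟩ ⟨ψ, h3, h4⟩
    exact ⟨φ + ψ, by simp [h1, h3], by simpa using h2.add h4⟩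
  zero_mem' := ⟨0, by simp, by simp⟩
  smul_mem' := by
    rintro a p ⟨φ, h1, h2⟩
    exact ⟨a • φ, by simp [h1], by simpa using h2.const_smul a⟩

/-- The operator `U(ξ; T) = ∑ ξ^k / k! U_k(T)` in `L²[-1,1]`, defined on the smooth functions on
`[-1,1]` for which the series converges in `L²[-1,1]`. -/
def heunU (c ξ : ℝ) : L2 →ₗ.[ℂ] L2 := (heunUGraph c ξ).toLinearPMap

/-! ### `U(ξ; T)` is well defined -/

theorem toL2_heunT (c : ℝ) {φ : Smooth} (h : toL2 φ = 0) : toL2 (heunT c φ) = 0 := by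
  have hz : ∀ ψ : Smooth, toL2 ψ = 0 ↔ (ψ : ℝ → ℂ) =ᵐ[vol] 0 := fun ψ =>
    (MemLp.toLp_eq_toLp_iff (memLp_of_continuous (contDiff_of_smooth ψ).continuous) MemLp.zero)
  rw [hz] at h ⊢
  have h0 : EqOn (φ : ℝ → ℂ) 0 (Icc (-1) 1) :=
    Measure.eqOn_Icc_of_ae_eq volume (by norm_num) h
      (contDiff_of_smooth φ).continuous.continuousOn continuousOn_const
  have key : ∀ x ∈ Ioo (-1 : ℝ) 1, ((heunT c φ : Smooth) : ℝ → ℂ) x = 0 := by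
    intro x hx
    have e0 : (φ : ℝ → ℂ) =ᶠ[𝓝 x] fun _ => 0 := by
      filter_upwards [Ioo_mem_nhds hx.1 hx.2] with y hy using h0 (Ioo_subset_Icc_self hy)
    have e1 := e0.deriv
    have e2 := e1.deriv
    have q0 := e0.eq_of_nhds
    have q1 := e1.eq_of_nhds
    have q2 := e2.eq_of_nhds
    simp only [deriv_const', deriv_const] at q0 q1 q2
    simp [heunT, q0, q1, q2]
  have hv : vol = volume.restrict (Ioo (-1 : ℝ) 1) :=
    (Measure.restrict_congr_set Ioo_ae_eq_Icc).symm
  rw [hv]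
  exact (ae_restrict_iff' measurableSet_Ioo).2 (Eventually.of_forall key)

theorem toL2_aeval_heunT (c : ℝ) (p : Polynomial ℂ) {φ : Smooth} (h : toL2 φ = 0) :
    toL2 (Polynomial.aeval (heunT c) p φ) = 0 := by
  induction p using Polynomial.induction_on' generalizing φ with
  | add p q hp hq => simp [hp h, hq h]
  | monomial n a =>
    have : ∀ n : ℕ, toL2 ((heunT c ^ n) φ) = 0 := by
      intro n
      induction n with
      | zero => simpa using h
      | succ n ih => rw [pow_succ', Module.End.mul_apply]; exact toL2_heunT c ih
    simp [Polynomial.aeval_monomial, this]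

/-- The graph of `U(ξ; T)` is single valued. -/
theorem heunUGraph_functional (c ξ : ℝ) :
    ∀ p ∈ heunUGraph c ξ, p.1 = 0 → p.2 = 0 := by
  rintro p ⟨φ, h1, h2⟩ h0
  have hs : ∀ N, heunPartialSum c ξ N φ = 0 := by
    intro N
    simp [heunPartialSum, toL2_aeval_heunT c _ (h1.trans h0)]
  simp only [hs] at h2
  exact (tendsto_nhds_unique h2 tendsto_const_nhds)

theorem heunU_graph (c ξ : ℝ) : (heunU c ξ).graph = heunUGraph c ξ :=
  Submodule.toLinearPMap_graph_eq _ fun p hp h => heunUGraph_functional c ξ p hp h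

end

end TimeBand

/-!
The generating function `u(ξ) = ∑ ξ^k / k! U_k(λ)` of the recursion solves, in the variable
`x = 1 - ξ`, the Heun equation `T y = λ y`: it is the solution that is regular at the singular
point `x = 1`, normalized by `y(1) = 1`. Hence on an eigenfunction `ψ` of `T` with eigenvalue `λ`
the operator `U(ξ; T)` is multiplication by `ψ(1 - ξ) / ψ(1)`
(`IsHeunEigenfunction.hasSum_heunMultiplier`). The eigenfunctions used are Fourier transforms of
densities on `[-1,1]`, so they are entire: the Taylor series about `1` converges on the whole line,
and the equation determines it from `ψ(1)` alone (`neg_one_pow_mul_deriv_at_one`). In particular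
`ψ(1) ≠ 0` and eigenspaces are one-dimensional.

There are enough such eigenfunctions. `T` is symmetric and commutes with `F_c`
(`inner_heunT_left`, `heunT_fourierSmooth`), so it acts on the finite-dimensional eigenspaces of the
compact injective self-adjoint operator `F_c^* F_c` and is diagonalized there
(`exists_hilbertBasis_heunEigenfunctions`). Compactness comes from truncating the exponential series
of the kernel, injectivity from the vanishing of all moments.

The eigenvalues are `≤ 0`, and an energy estimate for the Heun equation bounds `|ψ / ψ(1)|` on
`[0,1]` by a constant independent of the eigenvalue (`sq_le_of_heun_equation`). So the multipliers
define a bounded operator `V(ξ)`. Every pair in the graph of `U(ξ; T)` lies in the graph of `V(ξ)`,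
by symmetry of `T`, and the graph of `U(ξ; T)` contains the graph of `V(ξ)` over the eigenfunctions;
therefore `V(ξ)` is the closure (`isClosable_and_closure_eq`).

Since the eigenspaces are one-dimensional, `F_c` and the reflection also act on `ψ` by scalars, and
the integral formula on `ψ` is the identity `F_c ψ (1) = ∫₀¹ (e^{ict} ψ(t) + e^{-ict} ψ(-t)) dt`
with `t = 1 - ξ`. Both sides of the formula are bounded operators, so it holds on all of `L²[-1,1]`.
-/

namespace TimeBand

open scoped InnerProductSpace ComplexConjugate

/-! ### Calculus of the finite Fourier transform -/

theorem integrable_continuous_mul {g φ : ℝ → ℂ} (hg : Continuous g) (hφ : Integrable φ vol) :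
    Integrable (fun t => g t * φ t) vol := by
  obtain ⟨C, hC⟩ := (isCompact_Icc (a := (-1 : ℝ)) (b := 1)).exists_bound_of_continuousOn
    hg.continuousOn
  exact hφ.bdd_mul hg.aestronglyMeasurable
    ((ae_restrict_iff' measurableSet_Icc).2 (Eventually.of_forall hC))

/-- The density whose finite Fourier transform is the `k`-th derivative of that of `φ`. -/
noncomputable def diffDensity (c : ℝ) (k : ℕ) (φ : ℝ → ℂ) (t : ℝ) : ℂ :=
  (Complex.I * c * t) ^ k * φ t

theorem integrable_diffDensity (c : ℝ) (k : ℕ) {φ : ℝ → ℂ} (hφ : Integrable φ vol) :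
    Integrable (diffDensity c k φ) vol :=
  integrable_continuous_mul (by fun_prop) hφ

theorem hasDerivAt_exp_kernel (c t x : ℝ) :
    HasDerivAt (fun x : ℝ => Complex.exp (Complex.I * c * x * t))
      (Complex.I * c * t * Complex.exp (Complex.I * c * x * t)) x := by
  have h : HasDerivAt (fun x : ℝ => Complex.I * c * x * t) (Complex.I * c * t) x := by
    have := (((hasDerivAt_id x).ofReal_comp).const_mul (Complex.I * c)).mul_const (t : ℂ)
    simpa using this
  simpa [mul_comm] using h.cexp

theorem hasDerivAt_fourierFun (c : ℝ) {φ : ℝ → ℂ} (hφ : Integrable φ vol) (x : ℝ) :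
    HasDerivAt (fourierFun c φ) (fourierFun c (diffDensity c 1 φ) x) x := by
  have hi := integrable_diffDensity c 1 hφ
  refine (hasDerivAt_integral_of_dominated_loc_of_deriv_le (μ := vol) (s := univ) (x₀ := x)
    (F := fun (x : ℝ) t => Complex.exp (Complex.I * c * x * t) * φ t)
    (F' := fun (x : ℝ) t => Complex.exp (Complex.I * c * x * t) * diffDensity c 1 φ t)
    (bound := fun t => ‖diffDensity c 1 φ t‖) univ_mem ?_ ?_ ?_ ?_ hi.norm ?_).2
  · exact Eventually.of_forall fun y => (integrable_kernel c y hφ).aestronglyMeasurable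
  · exact integrable_kernel c x hφ
  · exact (integrable_kernel c x hi).aestronglyMeasurable
  · exact Eventually.of_forall fun t y _ => by rw [norm_mul, norm_exp_kernel, one_mul]
  · refine Eventually.of_forall fun t y _ => ?_
    refine ((hasDerivAt_exp_kernel c t y).mul_const (φ t)).congr_deriv ?_
    simp only [diffDensity]
    ring

theorem diffDensity_succ (c : ℝ) (k : ℕ) (φ : ℝ → ℂ) :
    diffDensity c 1 (diffDensity c k φ) = diffDensity c (k + 1) φ := by
  funext t
  simp only [diffDensity]
  ring

theorem hasDerivAt_fourierFun_diffDensity (c : ℝ) (k : ℕ) {φ : ℝ → ℂ} (hφ : Integrable φ vol)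
    (x : ℝ) :
    HasDerivAt (fourierFun c (diffDensity c k φ)) (fourierFun c (diffDensity c (k + 1) φ) x) x := by
  rw [← diffDensity_succ]
  exact hasDerivAt_fourierFun c (integrable_diffDensity c k hφ) x

theorem deriv_fourierFun (c : ℝ) {φ : ℝ → ℂ} (hφ : Integrable φ vol) :
    deriv (fourierFun c φ) = fourierFun c (diffDensity c 1 φ) :=
  funext fun x => (hasDerivAt_fourierFun c hφ x).deriv

theorem deriv_deriv_fourierFun (c : ℝ) {φ : ℝ → ℂ} (hφ : Integrable φ vol) :
    deriv (deriv (fourierFun c φ)) = fourierFun c (diffDensity c 2 φ) := by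
  rw [deriv_fourierFun c hφ, deriv_fourierFun c (integrable_diffDensity c 1 hφ),
    diffDensity_succ]

theorem contDiff_fourierFun (c : ℝ) {φ : ℝ → ℂ} (hφ : Integrable φ vol) :
    ContDiff ℝ ∞ (fourierFun c φ) := by
  refine contDiff_infty.2 fun n => ?_
  induction n generalizing φ with
  | zero => exact contDiff_zero.2 (continuous_fourierFun c hφ)
  | succ n ih =>
    have h := contDiff_succ_iff_deriv (𝕜 := ℝ) (n := n) (f := fourierFun c φ)
    refine h.2 ⟨fun x => (hasDerivAt_fourierFun c hφ x).differentiableAt, by simp, ?_⟩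
    rw [deriv_fourierFun c hφ]
    exact ih (integrable_diffDensity c 1 hφ)

/-- A finite Fourier transform is the sum of its Taylor series about any real point. -/
theorem hasSum_taylor_fourierFun (c : ℝ) {φ : ℝ → ℂ} (hφ : Integrable φ vol) (x h : ℝ) :
    HasSum (fun k : ℕ => (h : ℂ) ^ k / k.factorial * fourierFun c (diffDensity c k φ) x)
      (fourierFun c φ (x + h)) := by
  have key : ∀ k : ℕ, (h : ℂ) ^ k / k.factorial * fourierFun c (diffDensity c k φ) x
      = ∫ t, (Complex.I * c * h * t) ^ k / k.factorial
          * (Complex.exp (Complex.I * c * x * t) * φ t) ∂vol := by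
    intro k
    rw [fourierFun, ← integral_const_mul]
    refine integral_congr_ae (Eventually.of_forall fun t => ?_)
    simp only [diffDensity]
    rw [show Complex.I * c * h * t = h * (Complex.I * c * t) by ring, mul_pow]
    ring
  have key2 : fourierFun c φ (x + h)
      = ∫ t, ∑' k : ℕ, (Complex.I * c * h * t) ^ k / k.factorial
          * (Complex.exp (Complex.I * c * x * t) * φ t) ∂vol := by
    rw [fourierFun]
    refine integral_congr_ae (Eventually.of_forall fun t => ?_)
    have e := NormedSpace.expSeries_div_hasSum_exp (Complex.I * c * h * t)
    rw [← Complex.exp_eq_exp_ℂ] at e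
    simp only
    rw [tsum_mul_right, e.tsum_eq, ← mul_assoc, ← Complex.exp_add]
    congr 2
    push_cast
    ring
  simp only [key]
  rw [key2]
  have hbd : ∀ (k : ℕ), ∀ t ∈ Icc (-1 : ℝ) 1,
      ‖(Complex.I * c * h * t) ^ k / k.factorial * (Complex.exp (Complex.I * c * x * t) * φ t)‖
        ≤ |c * h| ^ k / k.factorial * ‖φ t‖ := by
    intro k t ht
    rw [norm_mul, norm_mul, norm_exp_kernel, one_mul, norm_div, norm_pow, Complex.norm_natCast]
    gcongr
    have : ‖Complex.I * c * h * t‖ = |c * h| * |t| := by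
      simp [abs_mul]
    rw [this]
    exact mul_le_of_le_one_right (abs_nonneg _) (abs_le.2 ht)
  have hint : ∀ k : ℕ, Integrable (fun t : ℝ => (Complex.I * c * h * t) ^ k / k.factorial
      * (Complex.exp (Complex.I * c * x * t) * φ t)) vol := fun k =>
    integrable_continuous_mul (by fun_prop) (integrable_kernel c x hφ)
  refine hasSum_integral_of_summable_integral_norm hint ?_
  refine Summable.of_nonneg_of_le (fun k => integral_nonneg fun t => norm_nonneg _)
    (fun k => ?_) ((Real.summable_pow_div_factorial |c * h|).mul_right (∫ t, ‖φ t‖ ∂vol))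
  rw [← integral_const_mul]
  exact integral_mono_ae (hint k).norm (hφ.norm.const_mul _)
    ((ae_restrict_iff' measurableSet_Icc).2 (Eventually.of_forall (hbd k)))

theorem fourierFun_diffDensity_eq_zero_of_Icc {c : ℝ} {φ : ℝ → ℂ} (hφ : Integrable φ vol)
    (h : ∀ x ∈ Icc (-1 : ℝ) 1, fourierFun c φ x = 0) (k : ℕ) :
    ∀ x ∈ Ioo (-1 : ℝ) 1, fourierFun c (diffDensity c k φ) x = 0 := by
  induction k with
  | zero =>
    intro x hx
    have : diffDensity c 0 φ = φ := by funext t; simp [diffDensity]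
    rw [this]
    exact h x (Ioo_subset_Icc_self hx)
  | succ k ih =>
    intro x hx
    have e : fourierFun c (diffDensity c k φ) =ᶠ[𝓝 x] fun _ => 0 := by
      filter_upwards [Ioo_mem_nhds hx.1 hx.2] with y hy using ih y hy
    rw [← (hasDerivAt_fourierFun_diffDensity c k hφ x).deriv, e.deriv_eq, deriv_const]

/-- A finite Fourier transform vanishing on `[-1,1]` vanishes on the line. -/
theorem fourierFun_eq_zero_of_Icc {c : ℝ} {φ : ℝ → ℂ} (hφ : Integrable φ vol)
    (h : ∀ x ∈ Icc (-1 : ℝ) 1, fourierFun c φ x = 0) (y : ℝ) : fourierFun c φ y = 0 := by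
  have hs := hasSum_taylor_fourierFun c hφ 0 y
  simp only [fourierFun_diffDensity_eq_zero_of_Icc hφ h _ 0 (by norm_num), mul_zero,
    zero_add] at hs
  exact hs.unique hasSum_zero

/-- The moments of a density are the derivatives of its finite Fourier transform at `0`, and by
Weierstrass' theorem a density on `[-1,1]` with vanishing moments is zero. -/
theorem ae_eq_zero_of_fourierFun_eq_zero {c : ℝ} (hc : c ≠ 0) {φ : ℝ → ℂ}
    (hφ : Integrable φ vol) (h : ∀ x ∈ Icc (-1 : ℝ) 1, fourierFun c φ x = 0) :
    φ =ᵐ[vol] 0 := by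
  have hmom : ∀ k : ℕ, ∫ t, (t : ℂ) ^ k * φ t ∂vol = 0 := by
    intro k
    have h0 := fourierFun_diffDensity_eq_zero_of_Icc hφ h k 0 (by norm_num)
    have h1 : fourierFun c (diffDensity c k φ) 0
        = (Complex.I * c) ^ k * ∫ t, (t : ℂ) ^ k * φ t ∂vol := by
      rw [fourierFun, ← integral_const_mul]
      refine integral_congr_ae (Eventually.of_forall fun t => ?_)
      simp [diffDensity]
      ring
    rw [h1] at h0
    have hne : (Complex.I * c) ^ k ≠ 0 :=
      pow_ne_zero _ (mul_ne_zero Complex.I_ne_zero (Complex.ofReal_ne_zero.2 hc))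
    exact (mul_eq_zero.1 h0).resolve_left hne
  have hpoly : ∀ p : Polynomial ℝ, ∫ t, ((p.eval t : ℝ) : ℂ) * φ t ∂vol = 0 := by
    intro p
    induction p using Polynomial.induction_on' with
    | add p q hp hq =>
      simp only [Polynomial.eval_add, Complex.ofReal_add, add_mul]
      rw [integral_add (integrable_continuous_mul (by fun_prop) hφ)
        (integrable_continuous_mul (by fun_prop) hφ), hp, hq, add_zero]
    | monomial n a =>
      simp only [Polynomial.eval_monomial, Complex.ofReal_mul, Complex.ofReal_pow, mul_assoc]
      rw [integral_const_mul, hmom, mul_zero]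
  have hcont : ∀ g : ℝ → ℝ, Continuous g → ∫ t, (g t : ℂ) * φ t ∂vol = 0 := by
    intro g hg
    set K := ∫ t, ‖φ t‖ ∂vol with hK
    have hK0 : 0 ≤ K := integral_nonneg fun t => norm_nonneg _
    rw [← norm_le_zero_iff]
    refine le_of_forall_pos_le_add fun ε hε => ?_
    obtain ⟨p, hp⟩ := exists_polynomial_near_of_continuousOn (-1) 1 g hg.continuousOn
      (ε / (K + 1)) (by positivity)
    have e : ∫ t, (g t : ℂ) * φ t ∂vol = ∫ t, ((g t : ℂ) - (p.eval t : ℝ)) * φ t ∂vol := by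
      simp only [sub_mul]
      rw [integral_sub (integrable_continuous_mul (by fun_prop) hφ)
        (integrable_continuous_mul (by fun_prop) hφ), hpoly, sub_zero]
    rw [e, zero_add]
    calc ‖∫ t, ((g t : ℂ) - (p.eval t : ℝ)) * φ t ∂vol‖
        ≤ ∫ t, ε / (K + 1) * ‖φ t‖ ∂vol := by
          refine norm_integral_le_of_norm_le (hφ.norm.const_mul _)
            ((ae_restrict_iff' measurableSet_Icc).2 (Eventually.of_forall fun t ht => ?_))
          rw [norm_mul]
          gcongr
          rw [← Complex.ofReal_sub, Complex.norm_real, Real.norm_eq_abs, abs_sub_comm]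
          exact (hp t ht).le
      _ = ε / (K + 1) * K := integral_const_mul _ _
      _ ≤ ε := by
          rw [div_mul_eq_mul_div, div_le_iff₀ (by positivity)]
          nlinarith
  refine ae_eq_zero_of_integral_contDiff_smul_eq_zero hφ.locallyIntegrable fun g hg _ => ?_
  simpa [Complex.real_smul] using hcont g hg.continuous

/-- The finite Fourier transform of a function in `L²[-1,1]`, as a smooth function on the line. -/
noncomputable def fourierSmooth (c : ℝ) : L2 →ₗ[ℂ] Smooth where
  toFun f := ⟨fourierFun c f, Set.mem_ofPred.2 (contDiff_fourierFun c (integrable_L2 f))⟩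
  map_add' f g := by
    refine Subtype.ext (funext fun x => ?_)
    simp only [Submodule.coe_add, Pi.add_apply, fourierFun]
    rw [← integral_add (integrable_kernel c x (integrable_L2 f))
      (integrable_kernel c x (integrable_L2 g))]
    refine integral_congr_ae ?_
    filter_upwards [Lp.coeFn_add f g] with t ht
    rw [ht, Pi.add_apply, mul_add]
  map_smul' a f := by
    refine Subtype.ext (funext fun x => ?_)
    simp only [RingHom.id_apply, Submodule.coe_smul, Pi.smul_apply, fourierFun]
    rw [← integral_smul]
    refine integral_congr_ae ?_
    filter_upwards [Lp.coeFn_smul a f] with t ht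
    rw [ht, Pi.smul_apply, smul_eq_mul, smul_eq_mul]
    ring

theorem fourierSmooth_apply (c : ℝ) (f : L2) (x : ℝ) :
    (fourierSmooth c f : ℝ → ℂ) x = fourierFun c f x := rfl

theorem toL2_fourierSmooth (c : ℝ) (f : L2) : toL2 (fourierSmooth c f) = finiteFourier c f := rfl

theorem coeFn_toL2 (φ : Smooth) : (toL2 φ : ℝ → ℂ) =ᵐ[vol] φ :=
  MemLp.coeFn_toLp (memLp_of_continuous (contDiff_of_smooth φ).continuous)

theorem fourierSmooth_toL2 (c : ℝ) (φ : Smooth) (x : ℝ) :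
    (fourierSmooth c (toL2 φ) : ℝ → ℂ) x = fourierFun c φ x :=
  integral_congr_ae (by filter_upwards [coeFn_toL2 φ] with t ht; rw [ht])

theorem toL2_eq_toL2_iff (φ ψ : Smooth) :
    toL2 φ = toL2 ψ ↔ EqOn (φ : ℝ → ℂ) ψ (Icc (-1) 1) := by
  have h : toL2 φ = toL2 ψ ↔ (φ : ℝ → ℂ) =ᵐ[vol] ψ :=
    MemLp.toLp_eq_toLp_iff (memLp_of_continuous (contDiff_of_smooth φ).continuous)
      (memLp_of_continuous (contDiff_of_smooth ψ).continuous)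
  rw [h]
  exact ⟨fun h => Measure.eqOn_Icc_of_ae_eq volume (by norm_num) h
      (contDiff_of_smooth φ).continuous.continuousOn (contDiff_of_smooth ψ).continuous.continuousOn,
    fun h => (ae_restrict_iff' measurableSet_Icc).2 (Eventually.of_forall h)⟩

theorem finiteFourier_injective {c : ℝ} (hc : c ≠ 0) : Function.Injective (finiteFourier c) := by
  rw [← LinearMap.ker_eq_bot, LinearMap.ker_eq_bot']
  intro f hf
  rw [← toL2_fourierSmooth, ← map_zero toL2, toL2_eq_toL2_iff] at hf
  exact (Lp.eq_zero_iff_ae_eq_zero).2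
    (ae_eq_zero_of_fourierFun_eq_zero hc (integrable_L2 f) fun x hx => hf hx)

/-! ### The finite Fourier transform as a compact operator -/

theorem inner_toL2_left (φ : Smooth) (f : L2) :
    ⟪toL2 φ, f⟫_ℂ = ∫ t, conj ((φ : ℝ → ℂ) t) * f t ∂vol := by
  rw [L2.inner_def]
  refine integral_congr_ae ?_
  filter_upwards [coeFn_toL2 φ] with t ht
  rw [ht, RCLike.inner_apply, mul_comm]

theorem inner_toL2_toL2 (φ ψ : Smooth) :
    ⟪toL2 φ, toL2 ψ⟫_ℂ = ∫ t, conj ((φ : ℝ → ℂ) t) * (ψ : ℝ → ℂ) t ∂vol := by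
  rw [inner_toL2_left]
  refine integral_congr_ae ?_
  filter_upwards [coeFn_toL2 ψ] with t ht
  rw [ht]

theorem norm_toL2_le (φ : Smooth) {M : ℝ} (hM : ∀ t ∈ Icc (-1 : ℝ) 1, ‖(φ : ℝ → ℂ) t‖ ≤ M) :
    ‖toL2 φ‖ ≤ 2 * M := by
  have hM0 : 0 ≤ M := (norm_nonneg _).trans (hM 0 (by norm_num))
  have h : ‖toL2 φ‖ ^ 2 ≤ 2 * M ^ 2 := by
    have h1 : ((‖toL2 φ‖ ^ 2 : ℝ) : ℂ) = ∫ t, ((‖(φ : ℝ → ℂ) t‖ ^ 2 : ℝ) : ℂ) ∂vol := by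
      have := inner_self_eq_norm_sq_to_K (𝕜 := ℂ) (toL2 φ)
      rw [inner_toL2_toL2] at this
      push_cast
      refine this.symm.trans (integral_congr_ae (Eventually.of_forall fun t => ?_))
      simp only
      rw [Complex.conj_mul']
    rw [integral_complex_ofReal, Complex.ofReal_inj] at h1
    rw [h1]
    calc ∫ t, ‖(φ : ℝ → ℂ) t‖ ^ 2 ∂vol ≤ ∫ t, M ^ 2 ∂vol := by
          have hc : Continuous fun t => ‖(φ : ℝ → ℂ) t‖ ^ 2 :=
            (contDiff_of_smooth φ).continuous.norm.pow 2
          refine integral_mono_ae (hc.continuousOn.integrableOn_Icc)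
            (integrable_const _) ?_
          refine (ae_restrict_iff' measurableSet_Icc).2 (Eventually.of_forall fun t ht => ?_)
          have := hM t ht
          simp only
          gcongr
      _ = 2 * M ^ 2 := by
          rw [integral_const]
          simp [measureReal_def]
          norm_num
  refine abs_le_of_sq_le_sq' ?_ (by positivity) |>.2
  nlinarith

theorem norm_integral_mul_le {g : ℝ → ℂ} (hg : ContDiff ℝ ∞ g) {M : ℝ}
    (hM : ∀ t ∈ Icc (-1 : ℝ) 1, ‖g t‖ ≤ M) (f : L2) :
    ‖∫ t, g t * f t ∂vol‖ ≤ 2 * M * ‖f‖ := by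
  let φ : Smooth := ⟨fun t => conj (g t), Set.mem_ofPred.2 (Complex.conjCLE.contDiff.comp hg)⟩
  have h := inner_toL2_left φ f
  simp only [φ, Complex.conj_conj] at h
  rw [← h]
  refine (norm_inner_le_norm _ _).trans ?_
  gcongr
  exact norm_toL2_le _ fun t ht => by simpa [φ] using hM t ht

theorem contDiff_ofReal : ContDiff ℝ ∞ (fun x : ℝ => (x : ℂ)) := Complex.ofRealCLM.contDiff

theorem contDiff_exp_kernel (c x : ℝ) :
    ContDiff ℝ ∞ (fun t : ℝ => Complex.exp (Complex.I * c * x * t)) :=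
  (contDiff_const.mul contDiff_ofReal).cexp

theorem norm_finiteFourier_le (c : ℝ) (f : L2) : ‖finiteFourier c f‖ ≤ 4 * ‖f‖ := by
  rw [← toL2_fourierSmooth]
  refine (norm_toL2_le _ (M := 2 * 1 * ‖f‖) fun x _ => ?_).trans_eq (by ring)
  exact norm_integral_mul_le (contDiff_exp_kernel c x) (fun t _ => (norm_exp_kernel c x t).le) f

/-- The finite Fourier transform as a bounded operator. -/
noncomputable def finiteFourierL (c : ℝ) : L2 →L[ℂ] L2 :=
  (finiteFourier c).mkContinuous 4 (norm_finiteFourier_le c)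

theorem finiteFourierL_apply (c : ℝ) (f : L2) : finiteFourierL c f = finiteFourier c f := rfl

/-- The monomial `t ↦ t^k`. -/
noncomputable def monomialSmooth (k : ℕ) : Smooth :=
  ⟨fun t => (t : ℂ) ^ k, Set.mem_ofPred.2 (contDiff_ofReal.pow k)⟩

/-- The operator whose kernel is the Taylor polynomial of degree `< N` of `e^{icxt}`. -/
noncomputable def taylorFourier (c : ℝ) (N : ℕ) : L2 →L[ℂ] L2 :=
  ∑ k ∈ Finset.range N, ((Complex.I * c) ^ k / k.factorial) •
    (innerSL ℂ (toL2 (monomialSmooth k))).smulRight (toL2 (monomialSmooth k))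

theorem isCompactOperator_taylorFourier (c : ℝ) (N : ℕ) :
    IsCompactOperator (taylorFourier c N) := by
  have h : ∀ k : ℕ, taylorFourier c (k + 1) = taylorFourier c k
      + ((Complex.I * c) ^ k / k.factorial) •
        (innerSL ℂ (toL2 (monomialSmooth k))).smulRight (toL2 (monomialSmooth k)) := fun k =>
    Finset.sum_range_succ _ _
  induction N with
  | zero => simpa [taylorFourier] using isCompactOperator_zero
  | succ N ih =>
    rw [h]
    refine ih.add (IsCompactOperator.smul ?_ _)
    have h1 : IsCompactOperator (innerSL ℂ (toL2 (monomialSmooth N))) :=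
      isCompactOperator_of_locallyCompactSpace_dom _
    exact h1.clm_comp ((ContinuousLinearMap.id ℂ ℂ).smulRight (toL2 (monomialSmooth N)))

theorem hasSum_real_exp (y : ℝ) : HasSum (fun n : ℕ => y ^ n / n.factorial) (Real.exp y) := by
  have h := NormedSpace.expSeries_div_hasSum_exp y
  rwa [← Real.exp_eq_exp_ℝ] at h

theorem exp_sub_sum_le_exp_sub_sum {y z : ℝ} (hy : 0 ≤ y) (hyz : y ≤ z) (N : ℕ) :
    Real.exp y - ∑ m ∈ Finset.range N, y ^ m / m.factorial
      ≤ Real.exp z - ∑ m ∈ Finset.range N, z ^ m / m.factorial :=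
  hasSum_le (fun n => by gcongr) ((hasSum_nat_add_iff' N).2 (hasSum_real_exp y))
    ((hasSum_nat_add_iff' N).2 (hasSum_real_exp z))

theorem norm_finiteFourierL_sub_taylorFourier_le (c : ℝ) (N : ℕ) :
    ‖finiteFourierL c - taylorFourier c N‖
      ≤ 4 * (Real.exp |c| - ∑ m ∈ Finset.range N, |c| ^ m / m.factorial) := by
  set ε := Real.exp |c| - ∑ m ∈ Finset.range N, |c| ^ m / m.factorial with hε
  have hε0 : 0 ≤ ε := sub_nonneg.2 (Real.sum_le_exp_of_nonneg (abs_nonneg c) N)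
  refine ContinuousLinearMap.opNorm_le_bound _ (by positivity) fun f => ?_
  let φ : Smooth := ∑ k ∈ Finset.range N, ((Complex.I * c) ^ k / k.factorial
    * ⟪toL2 (monomialSmooth k), f⟫_ℂ) • monomialSmooth k
  have h1 : (finiteFourierL c - taylorFourier c N) f = toL2 (fourierSmooth c f - φ) := by
    rw [map_sub, toL2_fourierSmooth]
    simp [taylorFourier, φ, finiteFourierL_apply, smul_smul]
  rw [h1]
  refine (norm_toL2_le _ (M := 2 * ε * ‖f‖) fun x hx => ?_).trans_eq (by ring)
  let g : ℝ → ℂ := fun t => Complex.exp (Complex.I * c * x * t)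
    - ∑ k ∈ Finset.range N, (Complex.I * c * x * t) ^ k / k.factorial
  have hg : ContDiff ℝ ∞ g :=
    (contDiff_exp_kernel c x).sub (ContDiff.sum fun k _ =>
      ((contDiff_const.mul contDiff_ofReal).pow k).div_const _)
  have h2 : ((fourierSmooth c f - φ : Smooth) : ℝ → ℂ) x = ∫ t, g t * f t ∂vol := by
    have hi : ∀ k ∈ Finset.range N, Integrable
        (fun t : ℝ => (Complex.I * c * x * t) ^ k / k.factorial * f t) vol := fun k _ =>
      integrable_continuous_mul (by fun_prop) (integrable_L2 f)
    simp only [g, sub_mul, Finset.sum_mul]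
    rw [integral_sub (integrable_kernel c x (integrable_L2 f)) (integrable_finsetSum _ hi),
      integral_finsetSum _ hi]
    simp only [φ, AddSubgroupClass.coe_sub, Pi.sub_apply, fourierSmooth_apply, fourierFun,
      Submodule.coe_sum, Finset.sum_apply, Submodule.coe_smul, Pi.smul_apply, smul_eq_mul,
      inner_toL2_left]
    congr 1
    refine Finset.sum_congr rfl fun k _ => ?_
    rw [mul_assoc, ← integral_mul_const, ← integral_const_mul]
    refine integral_congr_ae (Eventually.of_forall fun t => ?_)
    simp only [monomialSmooth, map_pow, Complex.conj_ofReal]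
    ring
  rw [h2]
  refine norm_integral_mul_le hg (fun t ht => ?_) f
  have hn : ‖Complex.I * c * x * t‖ ≤ |c| := by
    rw [show ‖Complex.I * c * x * t‖ = |c| * (|x| * |t|) by simp [mul_assoc]]
    exact mul_le_of_le_one_right (abs_nonneg c)
      (mul_le_one₀ (abs_le.2 hx) (abs_nonneg t) (abs_le.2 ht))
  exact (Complex.norm_exp_sub_sum_le_exp_norm_sub_sum _ N).trans
    (exp_sub_sum_le_exp_sub_sum (norm_nonneg _) hn N)

theorem isCompactOperator_finiteFourierL (c : ℝ) : IsCompactOperator (finiteFourierL c) := by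
  refine isCompactOperator_of_tendsto (l := atTop) (F := taylorFourier c) ?_
    (Eventually.of_forall fun N => isCompactOperator_taylorFourier c N)
  rw [tendsto_iff_norm_sub_tendsto_zero]
  have h := ((tendsto_const_nhds (x := Real.exp |c|)).sub
    (hasSum_real_exp |c|).tendsto_sum_nat).const_mul 4
  rw [sub_self, mul_zero] at h
  refine squeeze_zero (fun _ => norm_nonneg _) (fun N => ?_) h
  rw [norm_sub_rev]
  exact norm_finiteFourierL_sub_taylorFourier_le c N

/-- The adjoint of the finite Fourier transform has the complex conjugate kernel. -/
theorem inner_finiteFourier_left (c : ℝ) (f g : L2) :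
    ⟪finiteFourier c f, g⟫_ℂ = ⟪f, finiteFourier (-c) g⟫_ℂ := by
  have h1 : ⟪finiteFourier c f, g⟫_ℂ
      = ∫ x, ∫ t, Complex.exp (Complex.I * ((-c : ℝ) : ℂ) * x * t) * (conj (f t) * g x)
          ∂vol ∂vol := by
    rw [← toL2_fourierSmooth, inner_toL2_left]
    refine integral_congr_ae (Eventually.of_forall fun x => ?_)
    simp only [fourierSmooth_apply, fourierFun]
    rw [← integral_conj, ← integral_mul_const]
    refine integral_congr_ae (Eventually.of_forall fun t => ?_)
    simp only [map_mul, ← Complex.exp_conj, Complex.conj_I, Complex.conj_ofReal]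
    push_cast
    ring_nf
  have h2 : ⟪f, finiteFourier (-c) g⟫_ℂ
      = ∫ t, ∫ x, Complex.exp (Complex.I * ((-c : ℝ) : ℂ) * x * t) * (conj (f t) * g x)
          ∂vol ∂vol := by
    rw [← toL2_fourierSmooth, L2.inner_def]
    refine integral_congr_ae ?_
    filter_upwards [coeFn_toL2 (fourierSmooth (-c) g)] with t ht
    rw [ht, RCLike.inner_apply, mul_comm, fourierSmooth_apply, fourierFun, ← integral_const_mul]
    refine integral_congr_ae (Eventually.of_forall fun x => ?_)
    ring_nf
  rw [h1, h2]
  refine integral_integral_swap (f := fun (x t : ℝ) =>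
    Complex.exp (Complex.I * ((-c : ℝ) : ℂ) * x * t)
    * (conj (f t) * g x)) ?_
  have hf : Integrable (fun t => conj (f t)) vol :=
    Complex.conjCLE.toContinuousLinearMap.integrable_comp (integrable_L2 f)
  have hp : Integrable (fun p : ℝ × ℝ => conj (f p.2) * g p.1) (vol.prod vol) := by
    simpa only [mul_comm] using (integrable_L2 g).mul_prod hf
  refine hp.bdd_mul (c := 1) ?_ (Eventually.of_forall fun p => (norm_exp_kernel _ _ _).le)
  exact (by fun_prop : Continuous fun p : ℝ × ℝ =>
    Complex.exp (Complex.I * ((-c : ℝ) : ℂ) * p.1 * p.2)).aestronglyMeasurable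

/-! ### Symmetry of the Heun operator -/

theorem heunT_apply (c : ℝ) (φ : Smooth) (x : ℝ) :
    (heunT c φ : ℝ → ℂ) x = (1 - (x : ℂ) ^ 2) * deriv (deriv (φ : ℝ → ℂ)) x
      - 2 * (x : ℂ) * deriv (φ : ℝ → ℂ) x - (c : ℂ) ^ 2 * (x : ℂ) ^ 2 * (φ : ℝ → ℂ) x := rfl

theorem heunT_neg (c : ℝ) : heunT (-c) = heunT c := by
  refine LinearMap.ext fun φ => Subtype.ext (funext fun x => ?_)
  simp [heunT_apply]

theorem continuous_smooth (φ : Smooth) : Continuous (φ : ℝ → ℂ) := (contDiff_of_smooth φ).continuous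

theorem integrable_of_continuous {g : ℝ → ℂ} (hg : Continuous g) : Integrable g vol :=
  hg.continuousOn.integrableOn_Icc

/-- Integration by parts; the boundary terms vanish because `1 - t²` vanishes at `±1`. -/
theorem integral_heunT_mul (c : ℝ) (φ ψ : Smooth) :
    ∫ t, (heunT c φ : ℝ → ℂ) t * (ψ : ℝ → ℂ) t ∂vol
      = -∫ t, ((1 - (t : ℂ) ^ 2) * (deriv (φ : ℝ → ℂ) t * deriv (ψ : ℝ → ℂ) t)
          + (c : ℂ) ^ 2 * (t : ℂ) ^ 2 * ((φ : ℝ → ℂ) t * (ψ : ℝ → ℂ) t)) ∂vol := by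
  have c1 := continuous_smooth φ
  have c2 := continuous_smooth ψ
  have c3 := (smooth_diff_deriv φ).continuous
  have c4 := (smooth_diff_deriv ψ).continuous
  have c5 := continuous_smooth (heunT c φ)
  have i1 : Integrable (fun t => (heunT c φ : ℝ → ℂ) t * (ψ : ℝ → ℂ) t) vol :=
    integrable_of_continuous (by fun_prop)
  have i2 : Integrable (fun t : ℝ => (1 - (t : ℂ) ^ 2) * (deriv (φ : ℝ → ℂ) t
      * deriv (ψ : ℝ → ℂ) t) + (c : ℂ) ^ 2 * (t : ℂ) ^ 2 * ((φ : ℝ → ℂ) t * (ψ : ℝ → ℂ) t)) vol :=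
    integrable_of_continuous (by fun_prop)
  rw [eq_neg_iff_add_eq_zero, ← integral_add i1 i2]
  have hd : ∀ t : ℝ, HasDerivAt
      (fun t : ℝ => (1 - (t : ℂ) ^ 2) * deriv (φ : ℝ → ℂ) t * (ψ : ℝ → ℂ) t)
      ((heunT c φ : ℝ → ℂ) t * (ψ : ℝ → ℂ) t
        + ((1 - (t : ℂ) ^ 2) * (deriv (φ : ℝ → ℂ) t * deriv (ψ : ℝ → ℂ) t)
          + (c : ℂ) ^ 2 * (t : ℂ) ^ 2 * ((φ : ℝ → ℂ) t * (ψ : ℝ → ℂ) t))) t := by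
    intro t
    have h0 : HasDerivAt (fun t : ℝ => 1 - (t : ℂ) ^ 2) (-(2 * (t : ℂ))) t := by
      have := ((hasDerivAt_id t).ofReal_comp.pow 2).const_sub 1
      simpa using this
    refine ((h0.mul (smooth_diff_deriv φ t).hasDerivAt).mul
      (smooth_diff ψ t).hasDerivAt).congr_deriv ?_
    rw [heunT_apply]
    simp only [Pi.mul_apply]
    ring
  rw [integral_Icc_eq_integral_Ioc, ← intervalIntegral.integral_of_le (by norm_num),
    intervalIntegral.integral_eq_sub_of_hasDerivAt (fun t _ => hd t)]
  · simp
  · exact (by fun_prop : Continuous fun t : ℝ => (heunT c φ : ℝ → ℂ) t * (ψ : ℝ → ℂ) t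
        + ((1 - (t : ℂ) ^ 2) * (deriv (φ : ℝ → ℂ) t * deriv (ψ : ℝ → ℂ) t)
          + (c : ℂ) ^ 2 * (t : ℂ) ^ 2 * ((φ : ℝ → ℂ) t * (ψ : ℝ → ℂ) t))).intervalIntegrable _ _

theorem integral_heunT_mul_comm (c : ℝ) (φ ψ : Smooth) :
    ∫ t, (heunT c φ : ℝ → ℂ) t * (ψ : ℝ → ℂ) t ∂vol
      = ∫ t, (φ : ℝ → ℂ) t * (heunT c ψ : ℝ → ℂ) t ∂vol := by
  have h : ∀ t, (φ : ℝ → ℂ) t * (heunT c ψ : ℝ → ℂ) t = (heunT c ψ : ℝ → ℂ) t * (φ : ℝ → ℂ) t :=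
    fun t => mul_comm _ _
  simp only [h]
  rw [integral_heunT_mul, integral_heunT_mul]
  simp only [mul_comm]

/-- The complex conjugate of a smooth function. -/
noncomputable def conjSmooth (φ : Smooth) : Smooth :=
  ⟨fun t => conj ((φ : ℝ → ℂ) t),
    Set.mem_ofPred.2 (Complex.conjCLE.contDiff.comp (contDiff_of_smooth φ))⟩

theorem deriv_conj {g : ℝ → ℂ} (hg : Differentiable ℝ g) :
    deriv (fun t => conj (g t)) = fun t => conj (deriv g t) :=
  funext fun t => (Complex.conjCLE.toContinuousLinearMap.hasFDerivAt.comp_hasDerivAt t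
    (hg t).hasDerivAt).deriv

theorem deriv_conjSmooth (φ : Smooth) :
    deriv (conjSmooth φ : ℝ → ℂ) = fun t => conj (deriv (φ : ℝ → ℂ) t) :=
  deriv_conj (smooth_diff φ)

theorem heunT_conjSmooth (c : ℝ) (φ : Smooth) :
    heunT c (conjSmooth φ) = conjSmooth (heunT c φ) := by
  refine Subtype.ext (funext fun x => ?_)
  have e : (conjSmooth (heunT c φ) : ℝ → ℂ) x = conj ((heunT c φ : ℝ → ℂ) x) := rfl
  rw [e, heunT_apply, heunT_apply, deriv_conjSmooth, deriv_conj (smooth_diff_deriv φ)]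
  simp only [conjSmooth, map_sub, map_mul, map_one, map_pow, Complex.conj_ofReal, map_ofNat]

theorem inner_heunT_left (c : ℝ) (φ ψ : Smooth) :
    ⟪toL2 (heunT c φ), toL2 ψ⟫_ℂ = ⟪toL2 φ, toL2 (heunT c ψ)⟫_ℂ := by
  rw [inner_toL2_toL2, inner_toL2_toL2]
  have h := integral_heunT_mul_comm c (conjSmooth φ) ψ
  rw [heunT_conjSmooth] at h
  exact h

theorem inner_heunT_self (c : ℝ) (φ : Smooth) :
    ∃ r : ℝ, 0 ≤ r ∧ ⟪toL2 φ, toL2 (heunT c φ)⟫_ℂ = ((-r : ℝ) : ℂ) := by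
  refine ⟨∫ t, ((1 - t ^ 2) * ‖deriv (φ : ℝ → ℂ) t‖ ^ 2
    + c ^ 2 * t ^ 2 * ‖(φ : ℝ → ℂ) t‖ ^ 2) ∂vol, ?_, ?_⟩
  · refine integral_nonneg_of_ae ((ae_restrict_iff' measurableSet_Icc).2
      (Eventually.of_forall fun t ht => ?_))
    have : 0 ≤ 1 - t ^ 2 := by nlinarith [ht.1, ht.2]
    simp only [Pi.zero_apply]
    positivity
  · rw [← inner_heunT_left, inner_toL2_toL2]
    have h := integral_heunT_mul c (conjSmooth φ) φ
    rw [heunT_conjSmooth] at h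
    refine h.trans ?_
    rw [Complex.ofReal_neg, ← integral_complex_ofReal, deriv_conjSmooth]
    congr 1
    refine integral_congr_ae (Eventually.of_forall fun t => ?_)
    simp only [conjSmooth, Complex.conj_mul']
    push_cast
    ring

/-! ### The Heun operator commutes with the finite Fourier transform -/

/-- The Fourier kernel `t ↦ e^{icxt}`, with `x` fixed. -/
noncomputable def kernelSmooth (c x : ℝ) : Smooth :=
  ⟨fun t => Complex.exp (Complex.I * c * x * t), Set.mem_ofPred.2 (contDiff_exp_kernel c x)⟩

theorem heunT_kernelSmooth (c x t : ℝ) :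
    (heunT c (kernelSmooth c x) : ℝ → ℂ) t = (-(1 - (t : ℂ) ^ 2) * c ^ 2 * x ^ 2
      - 2 * t * (Complex.I * c * x) - c ^ 2 * t ^ 2) * Complex.exp (Complex.I * c * x * t) := by
  have hs : ∀ s : ℝ, HasDerivAt (fun t : ℝ => Complex.exp (Complex.I * c * x * t))
      (Complex.I * c * x * Complex.exp (Complex.I * c * x * s)) s := by
    intro s
    have h : HasDerivAt (fun t : ℝ => Complex.I * c * x * t) (Complex.I * c * x) s := by
      simpa using ((hasDerivAt_id s).ofReal_comp).const_mul (Complex.I * c * x)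
    simpa [mul_comm] using h.cexp
  have d1 : deriv (kernelSmooth c x : ℝ → ℂ)
      = fun t : ℝ => Complex.I * c * x * Complex.exp (Complex.I * c * x * t) :=
    funext fun s => (hs s).deriv
  rw [heunT_apply, d1, ((hs t).const_mul _).deriv]
  simp only [kernelSmooth]
  linear_combination (1 - (t : ℂ) ^ 2) * c ^ 2 * x ^ 2
    * Complex.exp (Complex.I * c * x * t) * Complex.I_sq

/-- After integration by parts the operator acts on the kernel `e^{icxt}` in the variable `t`, and
`T_t e^{icxt} = T_x e^{icxt}`. -/
theorem heunT_fourierSmooth (c : ℝ) (φ : Smooth) :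
    heunT c (fourierSmooth c (toL2 φ)) = fourierSmooth c (toL2 (heunT c φ)) := by
  refine Subtype.ext (funext fun x => ?_)
  have hφ : Integrable (φ : ℝ → ℂ) vol := integrable_of_continuous (continuous_smooth φ)
  have e0 : (fourierSmooth c (toL2 φ) : ℝ → ℂ) = fourierFun c φ :=
    funext fun x => fourierSmooth_toL2 c φ x
  rw [fourierSmooth_toL2, heunT_apply, e0, deriv_deriv_fourierFun c hφ, deriv_fourierFun c hφ]
  have e1 : fourierFun c (heunT c φ) x
      = ∫ t, (heunT c (kernelSmooth c x) : ℝ → ℂ) t * (φ : ℝ → ℂ) t ∂vol := by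
    rw [integral_heunT_mul_comm]
    rfl
  rw [e1]
  have i := fun k => integrable_kernel c x (integrable_diffDensity c k hφ)
  have i12 : Integrable (fun t : ℝ =>
      (1 - (x : ℂ) ^ 2) * (Complex.exp (Complex.I * c * x * t) * diffDensity c 2 φ t)
        - 2 * (x : ℂ) * (Complex.exp (Complex.I * c * x * t) * diffDensity c 1 φ t)) vol :=
    ((i 2).const_mul _).sub ((i 1).const_mul _)
  simp only [fourierFun]
  rw [← integral_const_mul, ← integral_const_mul, ← integral_const_mul,
    ← integral_sub ((i 2).const_mul _) ((i 1).const_mul _),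
    ← integral_sub i12 ((integrable_kernel c x hφ).const_mul _)]
  refine integral_congr_ae (Eventually.of_forall fun t => ?_)
  simp only [heunT_kernelSmooth, diffDensity]
  linear_combination (1 - (x : ℂ) ^ 2) * c ^ 2 * t ^ 2
    * Complex.exp (Complex.I * c * x * t) * (φ : ℝ → ℂ) t * Complex.I_sq

theorem heunT_fourierSmooth_neg (c : ℝ) (φ : Smooth) :
    heunT c (fourierSmooth (-c) (toL2 φ)) = fourierSmooth (-c) (toL2 (heunT c φ)) := by
  rw [← heunT_neg c]
  exact heunT_fourierSmooth (-c) φ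

/-! ### Taylor coefficients at the endpoint -/

/-- The Heun equation, differentiated `k` times. The truncated indices `k - 1` and `k - 2` occur
only with a vanishing coefficient. -/
theorem heun_recursion {c : ℝ} {lam : ℂ} {D : ℕ → ℝ → ℂ}
    (hD : ∀ k x, HasDerivAt (D k) (D (k + 1) x) x)
    (h0 : ∀ x : ℝ, (1 - (x : ℂ) ^ 2) * D 2 x - 2 * x * D 1 x - (c : ℂ) ^ 2 * (x : ℂ) ^ 2 * D 0 x
      = lam * D 0 x) (k : ℕ) (x : ℝ) :
    (1 - (x : ℂ) ^ 2) * D (k + 2) x - 2 * (k + 1) * x * D (k + 1) x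
      - (k * (k + 1) + lam + (c : ℂ) ^ 2 * (x : ℂ) ^ 2) * D k x
      - 2 * (c : ℂ) ^ 2 * x * (k * D (k - 1) x)
      - (c : ℂ) ^ 2 * (k * (k - 1) * D (k - 2) x) = 0 := by
  induction k generalizing x with
  | zero =>
    simp only [Nat.cast_zero, zero_add, zero_mul, mul_zero, mul_one, sub_zero]
    linear_combination h0 x
  | succ k ih =>
    have hx : HasDerivAt (fun x : ℝ => (x : ℂ)) 1 x := (hasDerivAt_id x).ofReal_comp
    have hx2 : HasDerivAt (fun x : ℝ => (x : ℂ) ^ 2) (2 * (x : ℂ)) x := by simpa using hx.fun_pow 2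
    have h1 : HasDerivAt (fun x => (k : ℂ) * D (k - 1) x) (k * D k x) x := by
      cases k with
      | zero => simpa using hasDerivAt_const x (0 : ℂ)
      | succ k => exact (hD k x).const_mul _
    have h2 : HasDerivAt (fun x => (k : ℂ) * (k - 1) * D (k - 2) x)
        (k * (k - 1) * D (k - 1) x) x := by
      match k with
      | 0 => simpa using hasDerivAt_const x (0 : ℂ)
      | 1 => simpa using hasDerivAt_const x (0 : ℂ)
      | k + 2 => exact (hD k x).const_mul _
    have h := (((((hx2.const_sub 1).mul (hD (k + 2) x)).sub
      ((hx.const_mul (2 * ((k : ℂ) + 1))).mul (hD (k + 1) x))).sub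
      (((hx2.const_mul ((c : ℂ) ^ 2)).const_add ((k : ℂ) * (k + 1) + lam)).mul (hD k x))).sub
      ((hx.const_mul (2 * (c : ℂ) ^ 2)).mul h1)).sub (h2.const_mul ((c : ℂ) ^ 2))
    have hz := h.unique ((hasDerivAt_const x (0 : ℂ)).congr_of_eventuallyEq
      (Eventually.of_forall fun y => ih y))
    simp only [Nat.add_sub_cancel, show k + 1 - 2 = k - 1 by omega]
    push_cast
    linear_combination hz

theorem eval_heunPoly_succ (c : ℝ) (lam : ℂ) (k : ℕ) :
    2 * ((k : ℂ) + 1) * (heunPoly c (k + 1)).eval lam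
      = (lam + (c : ℂ) ^ 2 + k * (k + 1)) * (heunPoly c k).eval lam
        - 2 * (c : ℂ) ^ 2 * (k * (heunPoly c (k - 1)).eval lam)
        + (c : ℂ) ^ 2 * (k * (k - 1) * (heunPoly c (k - 2)).eval lam) := by
  have hk : (k : ℂ) + 1 ≠ 0 := Nat.cast_add_one_ne_zero k
  rw [heunPoly]
  simp only [Polynomial.eval_add, Polynomial.eval_sub, Polynomial.eval_mul, Polynomial.eval_C,
    Polynomial.eval_X]
  field_simp
  ring

/-- At `x = 1` the leading coefficient of the Heun equation vanishes, so the equation determines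
all derivatives from the value, through the recursion of the polynomials `U_k`. -/
theorem neg_one_pow_mul_deriv_at_one {c : ℝ} {lam : ℂ} {D : ℕ → ℝ → ℂ}
    (hD : ∀ k x, HasDerivAt (D k) (D (k + 1) x) x)
    (h0 : ∀ x : ℝ, (1 - (x : ℂ) ^ 2) * D 2 x - 2 * x * D 1 x - (c : ℂ) ^ 2 * (x : ℂ) ^ 2 * D 0 x
      = lam * D 0 x) (k : ℕ) :
    (-1) ^ k * D k 1 = (heunPoly c k).eval lam * D 0 1 := by
  induction k using Nat.strong_induction_on with
  | _ k ih =>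
    match k with
    | 0 => simp [heunPoly]
    | k + 1 =>
      have hr := heun_recursion hD h0 k 1
      have hu := eval_heunPoly_succ c lam k
      have hk : 2 * ((k : ℂ) + 1) ≠ 0 := mul_ne_zero two_ne_zero (Nat.cast_add_one_ne_zero k)
      have i0 := ih k (by omega)
      have i1 : (k : ℂ) * ((-1) ^ k * D (k - 1) 1)
          = -(k * ((heunPoly c (k - 1)).eval lam * D 0 1)) := by
        cases k with
        | zero => simp
        | succ k =>
          have := ih k (by omega)
          rw [Nat.add_sub_cancel, ← this]
          ring
      have i2 : (k : ℂ) * (k - 1) * ((-1) ^ k * D (k - 2) 1)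
          = k * (k - 1) * ((heunPoly c (k - 2)).eval lam * D 0 1) := by
        match k with
        | 0 => simp
        | 1 => simp
        | k + 2 =>
          have := ih k (by omega)
          rw [Nat.add_sub_cancel, ← this]
          ring
      refine mul_left_cancel₀ hk ?_
      push_cast at hr
      linear_combination (-1) ^ k * hr - D 0 1 * hu + (k * (k + 1) + lam + (c : ℂ) ^ 2) * i0
        + 2 * (c : ℂ) ^ 2 * i1 + (c : ℂ) ^ 2 * i2

/-! ### A uniform bound for the solutions of the Heun equation -/

/-- For `H = (1 - x²) y'² + (χ + 2c² - c²x²) y²` the equation gives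
`H' + (4c² + 2) H ≥ (y' + 2c² y)² ≥ 0` on `[0,1]`. -/
theorem sq_le_of_heun_equation {c χ : ℝ} (hc : c ≠ 0) (hχ : 0 ≤ χ) {y y₁ y₂ : ℝ → ℝ}
    (hy : ∀ x, HasDerivAt y (y₁ x) x) (hy₁ : ∀ x, HasDerivAt y₁ (y₂ x) x)
    (heq : ∀ x, (1 - x ^ 2) * y₂ x - 2 * x * y₁ x - c ^ 2 * x ^ 2 * y x = -χ * y x)
    {x : ℝ} (hx : x ∈ Icc (0 : ℝ) 1) :
    y x ^ 2 ≤ Real.exp (4 * c ^ 2 + 2) * y 1 ^ 2 := by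
  set K := 4 * c ^ 2 + 2 with hK
  let H : ℝ → ℝ := fun x => (1 - x ^ 2) * y₁ x ^ 2 + (χ + 2 * c ^ 2 - c ^ 2 * x ^ 2) * y x ^ 2
  have hH : ∀ x, HasDerivAt H
      (2 * x * y₁ x ^ 2 + 4 * c ^ 2 * y x * y₁ x - 2 * c ^ 2 * x * y x ^ 2) x := by
    intro x
    have hx2 : HasDerivAt (fun x : ℝ => x ^ 2) (2 * x) x := by simpa using hasDerivAt_pow 2 x
    have hs₁ : HasDerivAt (fun x => y₁ x ^ 2) (2 * y₁ x * y₂ x) x := by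
      simpa using (hy₁ x).fun_pow 2
    have hs : HasDerivAt (fun x => y x ^ 2) (2 * y x * y₁ x) x := by simpa using (hy x).fun_pow 2
    refine (((hx2.const_sub 1).mul hs₁).add
      (((hx2.const_mul (c ^ 2)).const_sub (χ + 2 * c ^ 2)).mul hs)).congr_deriv ?_
    linear_combination 2 * y₁ x * heq x
  have hG : ∀ x, HasDerivAt (fun x => Real.exp (K * x) * H x)
      (Real.exp (K * x) * (K * H x
        + (2 * x * y₁ x ^ 2 + 4 * c ^ 2 * y x * y₁ x - 2 * c ^ 2 * x * y x ^ 2))) x := by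
    intro x
    have he : HasDerivAt (fun x => Real.exp (K * x)) (Real.exp (K * x) * K) x := by
      simpa using ((hasDerivAt_id x).const_mul K).exp
    refine (he.mul (hH x)).congr_deriv ?_
    ring
  have hmono : MonotoneOn (fun x => Real.exp (K * x) * H x) (Icc 0 1) := by
    refine monotoneOn_of_deriv_nonneg (convex_Icc 0 1)
      (fun x _ => (hG x).continuousAt.continuousWithinAt)
      (fun x _ => (hG x).differentiableAt.differentiableWithinAt) fun x hx => ?_
    rw [interior_Icc] at hx
    rw [(hG x).deriv]
    refine mul_nonneg (Real.exp_pos _).le ?_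
    have hx0 := hx.1
    have hx1 := hx.2
    have e : K * H x + (2 * x * y₁ x ^ 2 + 4 * c ^ 2 * y x * y₁ x - 2 * c ^ 2 * x * y x ^ 2)
        = (y₁ x + 2 * c ^ 2 * y x) ^ 2 + (4 * c ^ 2 * (1 - x ^ 2) + 2 * (1 - x ^ 2) + 2 * x - 1)
            * y₁ x ^ 2
          + (K * χ + K * (c ^ 2 * (1 - x ^ 2)) + 2 * c ^ 2 * (1 - x)) * y x ^ 2 := by
      simp only [H, hK]
      ring
    have h1 : 0 ≤ 1 - x ^ 2 := by nlinarith
    have h2 : 0 ≤ 4 * c ^ 2 * (1 - x ^ 2) + 2 * (1 - x ^ 2) + 2 * x - 1 := by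
      have : 0 ≤ 4 * c ^ 2 * (1 - x ^ 2) := by positivity
      nlinarith
    have h3 : 0 ≤ 1 - x := by linarith
    rw [e]
    have hK0 : 0 ≤ K := by positivity
    positivity
  have hle : Real.exp (K * x) * H x ≤ Real.exp (K * 1) * H 1 :=
    hmono hx (right_mem_Icc.2 zero_le_one) hx.2
  have hc2 : 0 < χ + c ^ 2 := by positivity
  have hHx : (χ + c ^ 2) * y x ^ 2 ≤ H x := by
    have h1 : 0 ≤ 1 - x ^ 2 := by nlinarith [hx.1, hx.2]
    have h2 : H x = (χ + c ^ 2) * y x ^ 2 + (1 - x ^ 2) * y₁ x ^ 2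
        + c ^ 2 * (1 - x ^ 2) * y x ^ 2 := by simp only [H]; ring
    have h3 : 0 ≤ (1 - x ^ 2) * y₁ x ^ 2 + c ^ 2 * (1 - x ^ 2) * y x ^ 2 := by positivity
    linarith
  have hH1 : H 1 = (χ + c ^ 2) * y 1 ^ 2 := by simp only [H]; ring
  have hexp : 1 ≤ Real.exp (K * x) := Real.one_le_exp (mul_nonneg (by positivity) hx.1)
  have hHx0 : 0 ≤ H x := le_trans (by positivity) hHx
  rw [mul_one, hH1] at hle
  refine le_of_mul_le_mul_left ?_ hc2
  nlinarith

/-! ### Band-limited eigenfunctions of the Heun operator -/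

/-- A band-limited eigenfunction of the Heun operator: an eigenfunction, on the whole line, that is
the Fourier transform of an integrable density on `[-1,1]` and hence entire. The bandwidth `b` is
left free so that the notion is visibly stable under reflection. -/
structure IsHeunEigenfunction (c : ℝ) (lam : ℂ) (ψ : Smooth) : Prop where
  bandLimited : ∃ (b : ℝ) (φ : ℝ → ℂ), Integrable φ vol ∧ (ψ : ℝ → ℂ) = fourierFun b φ
  eigen : heunT c ψ = lam • ψ

namespace IsHeunEigenfunction

variable {c : ℝ} {lam : ℂ} {ψ ψ' : Smooth}

/-- The value of `U(ξ; T)` on an eigenfunction: the series sums to `ψ(1 - ξ) / ψ(1)`. -/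
theorem hasSum (h : IsHeunEigenfunction c lam ψ) (ξ : ℝ) :
    HasSum (fun k : ℕ => (ξ : ℂ) ^ k / k.factorial * ((heunPoly c k).eval lam * (ψ : ℝ → ℂ) 1))
      ((ψ : ℝ → ℂ) (1 - ξ)) := by
  obtain ⟨b, φ, hφ, e⟩ := h.bandLimited
  have e0 : diffDensity b 0 φ = φ := by funext t; simp [diffDensity]
  have key := neg_one_pow_mul_deriv_at_one (c := c) (lam := lam)
    (D := fun k => fourierFun b (diffDensity b k φ))
    (fun k x => hasDerivAt_fourierFun_diffDensity b k hφ x) (fun x => by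
      have hx := congrFun (congrArg Subtype.val h.eigen) x
      rw [heunT_apply, e, deriv_deriv_fourierFun b hφ, deriv_fourierFun b hφ] at hx
      simpa only [e0, Submodule.coe_smul, Pi.smul_apply, smul_eq_mul, e] using hx)
  have hs := hasSum_taylor_fourierFun b hφ 1 (-ξ)
  rw [e, sub_eq_add_neg]
  refine hs.congr_fun fun k => ?_
  have hk := key k
  simp only [e0] at hk
  rw [← hk, Complex.ofReal_neg, neg_pow (ξ : ℂ)]
  ring

theorem apply_one_ne_zero (h : IsHeunEigenfunction c lam ψ) (hψ : ψ ≠ 0) :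
    (ψ : ℝ → ℂ) 1 ≠ 0 := by
  intro h1
  refine hψ (Subtype.ext (funext fun x => ?_))
  have hs := h.hasSum (1 - x)
  rw [sub_sub_cancel, h1] at hs
  simp only [mul_zero] at hs
  exact hs.unique hasSum_zero

/-- Eigenspaces are one-dimensional. -/
theorem eq_smul (h : IsHeunEigenfunction c lam ψ) (h' : IsHeunEigenfunction c lam ψ')
    (h1 : (ψ : ℝ → ℂ) 1 ≠ 0) : ψ' = ((ψ' : ℝ → ℂ) 1 / (ψ : ℝ → ℂ) 1) • ψ := by
  refine Subtype.ext (funext fun x => ?_)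
  have hs := (h.hasSum (1 - x)).mul_left ((ψ' : ℝ → ℂ) 1 / (ψ : ℝ → ℂ) 1)
  have hs' := h'.hasSum (1 - x)
  rw [sub_sub_cancel] at hs hs'
  refine hs'.unique (hs.congr_fun fun k => ?_)
  field_simp

theorem toL2_ne_zero (h : IsHeunEigenfunction c lam ψ) (hψ : ψ ≠ 0) : toL2 ψ ≠ 0 := by
  intro h0
  obtain ⟨b, φ, hφ, e⟩ := h.bandLimited
  rw [← map_zero toL2, toL2_eq_toL2_iff] at h0
  refine hψ (Subtype.ext ?_)
  rw [e]
  exact funext fun x => fourierFun_eq_zero_of_Icc hφ (fun y hy => by rw [← e]; exact h0 hy) x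

/-- The eigenvalues are real and nonpositive. -/
theorem exists_eq_neg (h : IsHeunEigenfunction c lam ψ) (hψ : ψ ≠ 0) :
    ∃ χ : ℝ, 0 ≤ χ ∧ lam = ((-χ : ℝ) : ℂ) := by
  obtain ⟨r, hr, e⟩ := inner_heunT_self c ψ
  have hn : 0 < ‖toL2 ψ‖ ^ 2 := by
    have := norm_pos_iff.2 (h.toL2_ne_zero hψ)
    positivity
  rw [h.eigen, map_smul, inner_smul_right, inner_self_eq_norm_sq_to_K] at e
  refine ⟨r / ‖toL2 ψ‖ ^ 2, by positivity, ?_⟩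
  have hn' : ((‖toL2 ψ‖ : ℝ) : ℂ) ^ 2 ≠ 0 := by exact_mod_cast hn.ne'
  push_cast at e ⊢
  rw [← neg_div, eq_div_iff hn']
  exact e

/-- The bound is uniform in the eigenvalue; this is what makes `U(ξ; T)` bounded. -/
theorem norm_le (h : IsHeunEigenfunction c lam ψ) (hc : c ≠ 0) (hψ : ψ ≠ 0) {x : ℝ}
    (hx : x ∈ Icc (0 : ℝ) 1) :
    ‖(ψ : ℝ → ℂ) x‖ ≤ Real.exp (2 * c ^ 2 + 1) * ‖(ψ : ℝ → ℂ) 1‖ := by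
  obtain ⟨χ, hχ, rfl⟩ := h.exists_eq_neg hψ
  have heq : ∀ x, (heunT c ψ : ℝ → ℂ) x = ((-χ : ℝ) : ℂ) * (ψ : ℝ → ℂ) x := fun x =>
    congrFun (congrArg Subtype.val h.eigen) x
  simp only [heunT_apply] at heq
  -- The equation has real coefficients, so the real and imaginary parts of `ψ` satisfy it too.
  have key : ∀ L : ℂ →L[ℝ] ℝ, L ((ψ : ℝ → ℂ) x) ^ 2
      ≤ Real.exp (4 * c ^ 2 + 2) * L ((ψ : ℝ → ℂ) 1) ^ 2 := by
    intro L
    refine sq_le_of_heun_equation (y := fun x => L ((ψ : ℝ → ℂ) x))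
      (y₁ := fun x => L (deriv (ψ : ℝ → ℂ) x)) (y₂ := fun x => L (deriv (deriv (ψ : ℝ → ℂ)) x))
      hc hχ (fun x => L.hasFDerivAt.comp_hasDerivAt x (smooth_diff ψ x).hasDerivAt)
      (fun x => L.hasFDerivAt.comp_hasDerivAt x (smooth_diff_deriv ψ x).hasDerivAt) (fun x => ?_) hx
    have e := congrArg L (heq x)
    have s1 : (1 - (x : ℂ) ^ 2) * deriv (deriv (ψ : ℝ → ℂ)) x
        = (1 - x ^ 2) • deriv (deriv (ψ : ℝ → ℂ)) x := by rw [Complex.real_smul]; push_cast; rfl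
    have s2 : 2 * (x : ℂ) * deriv (ψ : ℝ → ℂ) x = (2 * x) • deriv (ψ : ℝ → ℂ) x := by
      rw [Complex.real_smul]; push_cast; rfl
    have s3 : (c : ℂ) ^ 2 * (x : ℂ) ^ 2 * (ψ : ℝ → ℂ) x = (c ^ 2 * x ^ 2) • (ψ : ℝ → ℂ) x := by
      rw [Complex.real_smul]; push_cast; rfl
    rw [s1, s2, s3, ← Complex.real_smul] at e
    simpa only [map_sub, map_smul, smul_eq_mul] using e
  have hre := key Complex.reCLM
  have him := key Complex.imCLM
  simp only [Complex.reCLM_apply, Complex.imCLM_apply] at hre him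
  have hsq : ‖(ψ : ℝ → ℂ) x‖ ^ 2 ≤ (Real.exp (2 * c ^ 2 + 1) * ‖(ψ : ℝ → ℂ) 1‖) ^ 2 := by
    rw [mul_pow, ← Real.exp_nat_mul, ← Complex.normSq_eq_norm_sq, ← Complex.normSq_eq_norm_sq,
      Complex.normSq_apply, Complex.normSq_apply]
    push_cast
    rw [show 2 * (2 * c ^ 2 + 1) = 4 * c ^ 2 + 2 by ring]
    nlinarith
  exact le_of_sq_le_sq hsq (by positivity)

theorem aeval_apply (h : IsHeunEigenfunction c lam ψ) (p : Polynomial ℂ) :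
    Polynomial.aeval (heunT c) p ψ = p.eval lam • ψ := by
  by_cases hψ : ψ = 0
  · simp [hψ]
  · exact Module.End.aeval_apply_of_hasEigenvector
      (Module.End.hasEigenvector_iff.2 ⟨Module.End.mem_eigenspace_iff.2 h.eigen, hψ⟩)

theorem fourierSmooth_toL2 (h : IsHeunEigenfunction c lam ψ) :
    IsHeunEigenfunction c lam (fourierSmooth c (toL2 ψ)) where
  bandLimited := ⟨c, toL2 ψ, integrable_L2 _, rfl⟩
  eigen := by rw [heunT_fourierSmooth, h.eigen, map_smul, map_smul]

end IsHeunEigenfunction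

/-- The reflection `t ↦ φ(-t)` of a smooth function. -/
noncomputable def reflectSmooth (φ : Smooth) : Smooth :=
  ⟨fun t => (φ : ℝ → ℂ) (-t), Set.mem_ofPred.2 ((contDiff_of_smooth φ).comp contDiff_neg)⟩

theorem reflection_toL2 (φ : Smooth) : reflection (toL2 φ) = toL2 (reflectSmooth φ) := by
  refine Lp.ext ?_
  have h1 := Lp.coeFn_compMeasurePreserving (toL2 φ) measurePreserving_neg
  have h2 := measurePreserving_neg.quasiMeasurePreserving.ae_eq_comp (coeFn_toL2 φ)
  exact (h1.trans h2).trans (coeFn_toL2 (reflectSmooth φ)).symm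

theorem heunT_reflectSmooth (c : ℝ) (φ : Smooth) :
    heunT c (reflectSmooth φ) = reflectSmooth (heunT c φ) := by
  refine Subtype.ext (funext fun x => ?_)
  have d1 : deriv (reflectSmooth φ : ℝ → ℂ) = fun t => -deriv (φ : ℝ → ℂ) (-t) :=
    funext fun t => deriv_comp_neg (φ : ℝ → ℂ) t
  have d2 : deriv (fun t => -deriv (φ : ℝ → ℂ) (-t)) x = deriv (deriv (φ : ℝ → ℂ)) (-x) := by
    rw [deriv.fun_neg, deriv_comp_neg, neg_neg]
  have e : (reflectSmooth (heunT c φ) : ℝ → ℂ) x = (heunT c φ : ℝ → ℂ) (-x) := rfl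
  rw [e, heunT_apply, heunT_apply, d1, d2]
  simp [reflectSmooth]

theorem IsHeunEigenfunction.reflectSmooth {c : ℝ} {lam : ℂ} {ψ : Smooth}
    (h : IsHeunEigenfunction c lam ψ) : IsHeunEigenfunction c lam (reflectSmooth ψ) where
  bandLimited := by
    obtain ⟨b, φ, hφ, e⟩ := h.bandLimited
    refine ⟨-b, φ, hφ, funext fun x => ?_⟩
    change (ψ : ℝ → ℂ) (-x) = _
    rw [e]
    simp [fourierFun]
  eigen := by
    rw [heunT_reflectSmooth, h.eigen]
    rfl

/-! ### Completeness of the eigenfunctions -/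

/-- The time-band limiting operator `F_c^* F_c`. -/
noncomputable def timeBandOp (c : ℝ) : L2 →L[ℂ] L2 := finiteFourierL (-c) ∘L finiteFourierL c

theorem timeBandOp_apply (c : ℝ) (f : L2) :
    timeBandOp c f = toL2 (fourierSmooth (-c) (toL2 (fourierSmooth c f))) := rfl

theorem isCompactOperator_timeBandOp (c : ℝ) : IsCompactOperator (timeBandOp c) :=
  (isCompactOperator_finiteFourierL c).clm_comp (finiteFourierL (-c))

theorem isSymmetric_timeBandOp (c : ℝ) : (timeBandOp c).IsSymmetric := by
  intro f g
  change ⟪finiteFourier (-c) (finiteFourier c f), g⟫_ℂ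
    = ⟪f, finiteFourier (-c) (finiteFourier c g)⟫_ℂ
  rw [inner_finiteFourier_left, neg_neg, ← inner_finiteFourier_left]

theorem timeBandOp_injective {c : ℝ} (hc : c ≠ 0) : Function.Injective (timeBandOp c) :=
  (finiteFourier_injective (neg_ne_zero.2 hc)).comp (finiteFourier_injective hc)

/-- The classes in `L²[-1,1]` of the band-limited eigenfunctions of the Heun operator. -/
def heunEigenvectors (c : ℝ) : Set L2 :=
  {f | ∃ (lam : ℂ) (ψ : Smooth), IsHeunEigenfunction c lam ψ ∧ toL2 ψ = f}

/-- An eigenspace of `F_c^* F_c` is finite-dimensional and consists of smooth functions; the Heun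
operator acts on it as a symmetric operator and so can be diagonalized there. -/
theorem eigenspace_timeBandOp_le (c : ℝ) {μ : ℂ} (hμ : μ ≠ 0) :
    Module.End.eigenspace (timeBandOp c : Module.End ℂ L2) μ
      ≤ Submodule.span ℂ (heunEigenvectors c) := by
  set E := Module.End.eigenspace (timeBandOp c : Module.End ℂ L2) μ
  have hfin : FiniteDimensional ℂ E :=
    ContinuousLinearMap.finite_dimensional_eigenspace (isCompactOperator_timeBandOp c) μ hμ
  -- `P` is the smooth representative of an element of `E`.
  let P : L2 →ₗ[ℂ] Smooth := μ⁻¹ • (fourierSmooth (-c) ∘ₗ toL2 ∘ₗ fourierSmooth c)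
  have hPapp : ∀ f, P f = μ⁻¹ • fourierSmooth (-c) (toL2 (fourierSmooth c f)) := fun f => rfl
  have hP : ∀ f ∈ E, toL2 (P f) = f := by
    intro f hf
    have h : timeBandOp c f = μ • f := Module.End.mem_eigenspace_iff.1 hf
    rw [hPapp, map_smul, ← timeBandOp_apply, h, inv_smul_smul₀ hμ]
  have hcomm : ∀ f ∈ E, heunT c (P f) = P (toL2 (heunT c (P f))) := by
    intro f hf
    conv_lhs => rw [hPapp, ← hP f hf]
    rw [map_smul, heunT_fourierSmooth_neg, heunT_fourierSmooth, hPapp (toL2 _)]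
  let T : L2 →ₗ[ℂ] L2 := toL2 ∘ₗ heunT c ∘ₗ P
  have hTapp : ∀ f, T f = toL2 (heunT c (P f)) := fun f => rfl
  have hT : ∀ f ∈ E, T f ∈ E := by
    intro f hf
    refine Module.End.mem_eigenspace_iff.2 ?_
    change timeBandOp c (T f) = μ • T f
    have h : toL2 (P (T f)) = T f := by rw [hTapp f, ← hcomm f hf]
    rw [timeBandOp_apply]
    conv_rhs => rw [← h, hPapp, map_smul, smul_inv_smul₀ hμ]
  have hsymm : (T.restrict hT).IsSymmetric := by
    intro f g
    change ⟪T f, (g : L2)⟫_ℂ = ⟪(f : L2), T g⟫_ℂ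
    conv_lhs => rw [← hP g g.2, hTapp, inner_heunT_left]
    rw [hP f f.2, hTapp]
  have htop : ⨆ lam, Module.End.eigenspace (T.restrict hT) lam = ⊤ :=
    Submodule.orthogonal_eq_bot_iff.1 hsymm.orthogonalComplement_iSup_eigenspaces_eq_bot
  have hmap : E = ⨆ lam, (Module.End.eigenspace (T.restrict hT) lam).map E.subtype := by
    rw [← Submodule.map_iSup, htop, Submodule.map_top, Submodule.range_subtype]
  rw [hmap]
  refine iSup_le fun lam => ?_
  rintro _ ⟨f, hf, rfl⟩
  refine Submodule.subset_span ⟨lam, P f, ⟨⟨-c, (μ⁻¹ • toL2 (fourierSmooth c f) : L2),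
    integrable_L2 _, ?_⟩, ?_⟩, hP f f.2⟩
  · have : P f = fourierSmooth (-c) (μ⁻¹ • toL2 (fourierSmooth c f)) := by rw [hPapp, map_smul]
    rw [this]
    rfl
  · have h := congrArg Subtype.val (Module.End.mem_eigenspace_iff.1 hf)
    have h' : T f = lam • (f : L2) := h
    rw [hcomm f f.2, ← hTapp, h', map_smul]

theorem orthogonal_span_heunEigenvectors {c : ℝ} (hc : c ≠ 0) :
    (Submodule.span ℂ (heunEigenvectors c))ᗮ = ⊥ := by
  have h := ContinuousLinearMap.orthogonalComplement_iSup_eigenspaces_eq_bot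
    (isCompactOperator_timeBandOp c) (isSymmetric_timeBandOp c)
  refine le_bot_iff.1 (h ▸ Submodule.orthogonal_le (iSup_le fun μ => ?_))
  by_cases hμ : μ = 0
  · subst hμ
    intro f hf
    have h0 : timeBandOp c f = (0 : ℂ) • f := Module.End.mem_eigenspace_iff.1 hf
    have : f = 0 := timeBandOp_injective hc (by rw [h0, zero_smul, map_zero])
    rw [this]
    exact zero_mem _
  · exact eigenspace_timeBandOp_le c hμ

theorem IsHeunEigenfunction.inner_eq_zero {c : ℝ} {lam lam' : ℂ} {ψ ψ' : Smooth}
    (h : IsHeunEigenfunction c lam ψ) (h' : IsHeunEigenfunction c lam' ψ') (hψ : ψ ≠ 0)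
    (hne : lam ≠ lam') : ⟪toL2 ψ, toL2 ψ'⟫_ℂ = 0 := by
  have e := inner_heunT_left c ψ ψ'
  obtain ⟨χ, -, hχ⟩ := h.exists_eq_neg hψ
  rw [h.eigen, h'.eigen, map_smul, map_smul, inner_smul_left, inner_smul_right, hχ,
    Complex.conj_ofReal, ← hχ] at e
  have e' : (lam - lam') * ⟪toL2 ψ, toL2 ψ'⟫_ℂ = 0 := by rw [sub_mul, e, sub_self]
  exact (mul_eq_zero.1 e').resolve_left (sub_ne_zero.2 hne)

/-- `L²[-1,1]` has a Hilbert basis of eigenfunctions of the Heun operator, the prolate spheroidal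
wave functions. -/
theorem exists_hilbertBasis_heunEigenfunctions {c : ℝ} (hc : c ≠ 0) :
    ∃ (ι : Type) (b : HilbertBasis ι ℂ L2) (lam : ι → ℂ) (ψ : ι → Smooth),
      ∀ i, IsHeunEigenfunction c (lam i) (ψ i) ∧ ψ i ≠ 0 ∧ b i = toL2 (ψ i) := by
  let ι := {lam : ℂ // ∃ ψ, IsHeunEigenfunction c lam ψ ∧ ‖toL2 ψ‖ = 1}
  choose ψ hψ hn using fun i : ι => i.2
  have h0 : ∀ i, ψ i ≠ 0 := by
    intro i hi
    have := hn i
    rw [hi, map_zero, norm_zero] at this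
    exact zero_ne_one this
  have horth : Orthonormal ℂ fun i => toL2 (ψ i) :=
    ⟨hn, fun i j hij => (hψ i).inner_eq_zero (hψ j) (h0 i) fun h => hij (Subtype.ext h)⟩
  have hspan : (Submodule.span ℂ (range fun i => toL2 (ψ i)))ᗮ = ⊥ := by
    refine le_bot_iff.1 (orthogonal_span_heunEigenvectors hc ▸ Submodule.orthogonal_le
      (Submodule.span_le.2 ?_))
    rintro _ ⟨lam, φ, hφ, rfl⟩
    by_cases hφ0 : φ = 0
    · rw [hφ0, map_zero]
      exact zero_mem _
    have hne := hφ.toL2_ne_zero hφ0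
    -- The index of the eigenvalue of `φ`, witnessed by the normalization of `φ`.
    let i : ι := ⟨lam, ((‖toL2 φ‖⁻¹ : ℝ) : ℂ) • φ, ⟨by
        obtain ⟨b, g, hg, e⟩ := hφ.bandLimited
        refine ⟨b, ((‖toL2 φ‖⁻¹ : ℝ) : ℂ) • g, hg.smul _, funext fun x => ?_⟩
        simp only [Submodule.coe_smul, e, Pi.smul_apply, fourierFun]
        rw [← integral_smul]
        refine integral_congr_ae (Eventually.of_forall fun t => ?_)
        simp only [smul_eq_mul]
        ring, by rw [map_smul, hφ.eigen, smul_comm]⟩, by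
        rw [map_smul, norm_smul, Complex.norm_real, norm_inv, norm_norm,
          inv_mul_cancel₀ (norm_ne_zero_iff.2 hne)]⟩
    rw [(hψ i).eq_smul hφ ((hψ i).apply_one_ne_zero (h0 i)), map_smul]
    exact Submodule.smul_mem _ _ (Submodule.subset_span ⟨i, rfl⟩)
  refine ⟨ι, HilbertBasis.mkOfOrthogonalEqBot horth hspan, Subtype.val, ψ, fun i =>
    ⟨hψ i, h0 i, ?_⟩⟩
  rw [HilbertBasis.coe_mkOfOrthogonalEqBot]

/-! ### Operators diagonal in a Hilbert basis -/

section Diagonal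

variable {ι E : Type*} [NormedAddCommGroup E] [InnerProductSpace ℂ E]

theorem _root_.HilbertBasis.ext_inner (b : HilbertBasis ι ℂ E) {f g : E}
    (h : ∀ i, ⟪b i, f⟫_ℂ = ⟪b i, g⟫_ℂ) : f = g := by
  refine b.repr.injective (lp.ext (funext fun i => ?_))
  rw [b.repr_apply_apply, b.repr_apply_apply, h]

theorem exists_diagonal_operator (b : HilbertBasis ι ℂ E) {m : ι → ℂ} {C : ℝ} (hC : 0 ≤ C)
    (hm : ∀ i, ‖m i‖ ≤ C) :
    ∃ V : E →L[ℂ] E, ‖V‖ ≤ C ∧ ∀ f i, ⟪b i, V f⟫_ℂ = m i * ⟪b i, f⟫_ℂ := by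
  have hmem : ∀ x : lp (fun _ : ι => ℂ) 2, Memℓp (fun i => m i * x i) 2 := fun x =>
    (((lp.memℓp x).norm).const_mul C).mono fun i => by
      rw [norm_mul]
      exact mul_le_mul_of_nonneg_right (hm i) (norm_nonneg _)
  let M : lp (fun _ : ι => ℂ) 2 →ₗ[ℂ] lp (fun _ : ι => ℂ) 2 :=
    { toFun := fun x => ⟨fun i => m i * x i, hmem x⟩
      map_add' := fun x y => lp.ext (funext fun i => mul_add (m i) (x i) (y i))
      map_smul' := fun a x => lp.ext (funext fun i => mul_left_comm (m i) a (x i)) }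
  have hM : ∀ x, ‖M x‖ ≤ C * ‖x‖ := by
    intro x
    have h1 : ‖M x‖ ≤ ‖(C : ℂ) • x‖ := by
      refine lp.norm_mono (by norm_num) fun i => ?_
      change ‖m i * x i‖ ≤ ‖(C : ℂ) * x i‖
      rw [norm_mul, norm_mul, Complex.norm_real, Real.norm_of_nonneg hC]
      exact mul_le_mul_of_nonneg_right (hm i) (norm_nonneg _)
    rwa [norm_smul, Complex.norm_real, Real.norm_of_nonneg hC] at h1
  let V : E →ₗ[ℂ] E :=
    b.repr.symm.toLinearEquiv.toLinearMap ∘ₗ M ∘ₗ b.repr.toLinearEquiv.toLinearMap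
  have hV : ∀ f, V f = b.repr.symm (M (b.repr f)) := fun f => rfl
  refine ⟨V.mkContinuous C fun f => ?_, V.mkContinuous_norm_le hC _, fun f i => ?_⟩
  · rw [hV, LinearIsometryEquiv.norm_map, ← b.repr.norm_map f]
    exact hM _
  · rw [LinearMap.mkContinuous_apply, hV, ← b.repr_apply_apply,
      LinearIsometryEquiv.apply_symm_apply, ← b.repr_apply_apply]
    rfl

theorem apply_eq_smul_of_inner (b : HilbertBasis ι ℂ E) {m : ι → ℂ} {V : E →L[ℂ] E}
    (hV : ∀ f i, ⟪b i, V f⟫_ℂ = m i * ⟪b i, f⟫_ℂ) (i : ι) : V (b i) = m i • b i := by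
  refine b.ext_inner fun j => ?_
  rw [hV, inner_smul_right]
  by_cases h : j = i
  · rw [h]
  · rw [b.orthonormal.2 h, mul_zero, mul_zero]

/-- Bounded families of operators that are strongly continuous on a basis are strongly
continuous. -/
theorem continuousOn_apply_of_basis (b : HilbertBasis ι ℂ E) {V : ℝ → E →L[ℂ] E} {C : ℝ}
    {s : Set ℝ} (hV : ∀ ξ ∈ s, ‖V ξ‖ ≤ C) (hb : ∀ i, ContinuousOn (fun ξ => V ξ (b i)) s) (f : E) :
    ContinuousOn (fun ξ => V ξ f) s := by
  have hspan : ∀ g ∈ Submodule.span ℂ (range b), ContinuousOn (fun ξ => V ξ g) s := by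
    intro g hg
    induction hg using Submodule.span_induction with
    | mem x hx => obtain ⟨i, rfl⟩ := hx; exact hb i
    | zero => simpa using continuousOn_const
    | add x y _ _ hx hy => simpa using hx.fun_add hy
    | smul a x _ hx => simpa using hx.fun_const_smul a
  have hf : f ∈ closure (Submodule.span ℂ (range b) : Set E) := by
    rw [← Submodule.topologicalClosure_coe, b.dense_span]
    trivial
  refine continuousOn_of_uniform_approx_of_continuousOn fun u hu => ?_
  obtain ⟨ε, hε, hεu⟩ := Metric.mem_uniformity_dist.1 hu
  obtain ⟨g, hg, hfg⟩ := Metric.mem_closure_iff.1 hf (ε / (|C| + 1)) (by positivity)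
  refine ⟨_, hspan g hg, fun ξ hξ => hεu ?_⟩
  rw [dist_eq_norm, ← map_sub]
  rw [dist_eq_norm, lt_div_iff₀ (by positivity)] at hfg
  calc ‖V ξ (f - g)‖ ≤ ‖V ξ‖ * ‖f - g‖ := (V ξ).le_opNorm _
    _ ≤ (|C| + 1) * ‖f - g‖ := by
        gcongr
        exact (hV ξ hξ).trans ((le_abs_self C).trans (by linarith))
    _ < ε := by rwa [mul_comm]

end Diagonal

/-! ### The closure of `U(ξ; T)` -/

theorem IsHeunEigenfunction.inner_aeval {c : ℝ} {lam : ℂ} {ψ : Smooth}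
    (h : IsHeunEigenfunction c lam ψ) (hψ : ψ ≠ 0) (p : Polynomial ℂ) (φ : Smooth) :
    ⟪toL2 ψ, toL2 (Polynomial.aeval (heunT c) p φ)⟫_ℂ = p.eval lam * ⟪toL2 ψ, toL2 φ⟫_ℂ := by
  obtain ⟨χ, -, hχ⟩ := h.exists_eq_neg hψ
  induction p using Polynomial.induction_on' with
  | add p q hp hq =>
    rw [map_add, LinearMap.add_apply, map_add, inner_add_right, hp, hq, Polynomial.eval_add,
      add_mul]
  | monomial n a =>
    have hn : ∀ n : ℕ, ⟪toL2 ψ, toL2 ((heunT c ^ n) φ)⟫_ℂ = lam ^ n * ⟪toL2 ψ, toL2 φ⟫_ℂ := by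
      intro n
      induction n with
      | zero => simp
      | succ n ih =>
        rw [pow_succ', Module.End.mul_apply, ← inner_heunT_left, h.eigen, map_smul,
          inner_smul_left, ih, hχ, Complex.conj_ofReal]
        ring
    rw [Polynomial.aeval_monomial, Module.End.mul_apply, Module.algebraMap_end_apply, map_smul,
      inner_smul_right, hn, Polynomial.eval_monomial, mul_assoc]

theorem heunPartialSum_apply (c ξ : ℝ) (N : ℕ) (φ : Smooth) :
    heunPartialSum c ξ N φ = ∑ k ∈ Finset.range N, ((ξ : ℂ) ^ k / (k.factorial : ℂ)) •
      toL2 (Polynomial.aeval (heunT c) (heunPoly c k) φ) := by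
  simp [heunPartialSum]

/-- The eigenvalue of `U(ξ; T)` on the eigenfunction `ψ`. -/
noncomputable def heunMultiplier (ψ : Smooth) (ξ : ℝ) : ℂ :=
  (ψ : ℝ → ℂ) (1 - ξ) / (ψ : ℝ → ℂ) 1

theorem IsHeunEigenfunction.hasSum_heunMultiplier {c : ℝ} {lam : ℂ} {ψ : Smooth}
    (h : IsHeunEigenfunction c lam ψ) (hψ : ψ ≠ 0) (ξ : ℝ) :
    HasSum (fun k : ℕ => (ξ : ℂ) ^ k / k.factorial * (heunPoly c k).eval lam)
      (heunMultiplier ψ ξ) := by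
  have h1 := h.apply_one_ne_zero hψ
  refine ((h.hasSum ξ).div_const ((ψ : ℝ → ℂ) 1)).congr_fun fun k => ?_
  field_simp

theorem IsHeunEigenfunction.norm_heunMultiplier_le {c : ℝ} {lam : ℂ} {ψ : Smooth}
    (h : IsHeunEigenfunction c lam ψ) (hc : c ≠ 0) (hψ : ψ ≠ 0) {ξ : ℝ} (hξ : ξ ∈ Icc (0 : ℝ) 1) :
    ‖heunMultiplier ψ ξ‖ ≤ Real.exp (2 * c ^ 2 + 1) := by
  rw [heunMultiplier, norm_div, div_le_iff₀ (norm_pos_iff.2 (h.apply_one_ne_zero hψ))]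
  exact h.norm_le hc hψ ⟨by linarith [hξ.2], by linarith [hξ.1]⟩

theorem IsHeunEigenfunction.mem_heunUGraph {c : ℝ} {lam : ℂ} {ψ : Smooth}
    (h : IsHeunEigenfunction c lam ψ) (hψ : ψ ≠ 0) (ξ : ℝ) :
    (toL2 ψ, heunMultiplier ψ ξ • toL2 ψ) ∈ heunUGraph c ξ := by
  refine ⟨ψ, rfl, ?_⟩
  have hs := (h.hasSum_heunMultiplier hψ ξ).tendsto_sum_nat.smul_const (toL2 ψ)
  refine hs.congr fun N => ?_
  rw [heunPartialSum_apply, Finset.sum_smul]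
  refine Finset.sum_congr rfl fun k _ => ?_
  rw [h.aeval_apply, map_smul, smul_smul]

/-- By symmetry of the polynomials in `T` every value of `U(ξ; T)`, on eigenfunctions or not, has
the coefficients prescribed by the multipliers. -/
theorem IsHeunEigenfunction.inner_of_mem_heunUGraph {c : ℝ} {lam : ℂ} {ψ : Smooth}
    (h : IsHeunEigenfunction c lam ψ) (hψ : ψ ≠ 0) {ξ : ℝ} {p : L2 × L2}
    (hp : p ∈ heunUGraph c ξ) :
    ⟪toL2 ψ, p.2⟫_ℂ = heunMultiplier ψ ξ * ⟪toL2 ψ, p.1⟫_ℂ := by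
  obtain ⟨φ, h1, h2⟩ := hp
  have l1 : Tendsto (fun N => ⟪toL2 ψ, heunPartialSum c ξ N φ⟫_ℂ) atTop (𝓝 ⟪toL2 ψ, p.2⟫_ℂ) :=
    tendsto_const_nhds.inner h2
  have l2 := (h.hasSum_heunMultiplier hψ ξ).tendsto_sum_nat.mul_const ⟪toL2 ψ, p.1⟫_ℂ
  refine tendsto_nhds_unique l1 (l2.congr fun N => ?_)
  rw [heunPartialSum_apply, inner_sum, Finset.sum_mul, ← h1]
  refine Finset.sum_congr rfl fun k _ => ?_
  rw [inner_smul_right, h.inner_aeval hψ, mul_assoc]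

/-- A linear partial map is closable with everywhere defined continuous closure `V` as soon as it
is a restriction of `V` and its graph contains the graph of `V` over a total set. -/
theorem isClosable_and_closure_eq {E F : Type*} [NormedAddCommGroup E] [NormedSpace ℂ E]
    [NormedAddCommGroup F] [NormedSpace ℂ F] {U : E →ₗ.[ℂ] F} {V : E →L[ℂ] F}
    (hU : ∀ p ∈ U.graph, V p.1 = p.2) {s : Set E}
    (hs : (Submodule.span ℂ s).topologicalClosure = ⊤) (hsU : ∀ f ∈ s, (f, V f) ∈ U.graph) :
    U.IsClosable ∧ U.closure = (V : E →ₗ[ℂ] F).toPMap ⊤ := by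
  have hmem : ∀ p : E × F, p ∈ ((V : E →ₗ[ℂ] F).toPMap ⊤).graph ↔ V p.1 = p.2 := by
    intro p
    rw [LinearPMap.mem_graph_iff]
    refine ⟨?_, fun h => ⟨⟨p.1, trivial⟩, rfl, h⟩⟩
    rintro ⟨y, hy1, hy2⟩
    rw [← hy1]
    exact hy2
  have key : U.graph.topologicalClosure = ((V : E →ₗ[ℂ] F).toPMap ⊤).graph := by
    refine le_antisymm (Submodule.topologicalClosure_minimal _ (fun p hp => ?_) ?_) fun p hp => ?_
    · exact (hmem p).2 (hU p hp)
    · have : (((V : E →ₗ[ℂ] F).toPMap ⊤).graph : Set (E × F)) = {p | V p.1 = p.2} :=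
        Set.ext hmem
      rw [this]
      exact isClosed_eq (V.continuous.comp continuous_fst) continuous_snd
    · let J : E →L[ℂ] E × F := (ContinuousLinearMap.id ℂ E).prod V
      have hle : (Submodule.span ℂ s).topologicalClosure
          ≤ U.graph.topologicalClosure.comap (J : E →ₗ[ℂ] E × F) := by
        refine Submodule.topologicalClosure_minimal _ (Submodule.span_le.2 fun f hf => ?_) ?_
        · exact U.graph.le_topologicalClosure (hsU f hf)
        · exact U.graph.isClosed_topologicalClosure.preimage J.continuous
      rw [hs] at hle
      have := hle (show p.1 ∈ ⊤ from trivial)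
      have e : p = J p.1 := Prod.ext rfl ((hmem p).1 hp).symm
      rw [e]
      exact this
  have hcl : U.IsClosable := ⟨_, key⟩
  exact ⟨hcl, LinearPMap.eq_of_eq_graph (hcl.graph_closure_eq_closure_graph.symm.trans key)⟩

/-! ### The integral formula -/

/-- The value of the finite Fourier transform at `1`, folded onto `[0,1]`:
`F_c φ (1) = ∫₀¹ (e^{ict} φ(t) + e^{-ict} φ(-t)) dt` with `t = 1 - ξ`. -/
theorem fourierFun_one_eq (c : ℝ) {φ : ℝ → ℂ} (hφ : Continuous φ) :
    fourierFun c φ 1 = ∫ ξ in (0 : ℝ)..1, (Complex.exp (Complex.I * c * (1 - ξ)) * φ (1 - ξ)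
      + Complex.exp (-(Complex.I * c * (1 - ξ))) * φ (-(1 - ξ))) := by
  have hg : Continuous fun t : ℝ => Complex.exp (Complex.I * c * t) * φ t := by fun_prop
  have hg' : Continuous fun t : ℝ => Complex.exp (-(Complex.I * c * t)) * φ (-t) := by fun_prop
  have h1 := intervalIntegral.integral_comp_sub_left (a := 0) (b := 1)
    (fun t : ℝ => Complex.exp (Complex.I * c * t) * φ t
      + Complex.exp (-(Complex.I * c * t)) * φ (-t)) 1
  have h2 := intervalIntegral.integral_comp_neg (a := 0) (b := 1)
    (fun t : ℝ => Complex.exp (Complex.I * c * t) * φ t)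
  have h3 := intervalIntegral.integral_add_adjacent_intervals
    (hg.intervalIntegrable (μ := volume) (-1) 0) (hg.intervalIntegrable 0 1)
  simp only [sub_self, sub_zero] at h1
  rw [intervalIntegral.integral_add (hg.intervalIntegrable _ _) (hg'.intervalIntegrable _ _)] at h1
  push_cast at h1 h2
  simp only [mul_neg, neg_zero] at h2
  rw [h1, h2, add_comm, h3, fourierFun, integral_Icc_eq_integral_Ioc,
    ← intervalIntegral.integral_of_le (by norm_num)]
  simp

/-- The eigenspace being one-dimensional, `F_c` and the reflection act on `ψ` by scalars, which are
read off at `x = 1`. -/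
theorem IsHeunEigenfunction.finiteFourier_eq_integral {c : ℝ} {lam : ℂ} {ψ : Smooth}
    (h : IsHeunEigenfunction c lam ψ) (hψ : ψ ≠ 0) :
    finiteFourier c (toL2 ψ) = ∫ ξ in (0 : ℝ)..1,
      (Complex.exp (Complex.I * c * (1 - ξ)) • ContinuousLinearMap.id ℂ L2
        + Complex.exp (-(Complex.I * c * (1 - ξ))) • reflection) (heunMultiplier ψ ξ • toL2 ψ) := by
  have h1 := h.apply_one_ne_zero hψ
  have hF : finiteFourier c (toL2 ψ) = (fourierFun c ψ 1 / (ψ : ℝ → ℂ) 1) • toL2 ψ := by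
    rw [← toL2_fourierSmooth, h.eq_smul h.fourierSmooth_toL2 h1, map_smul,
      TimeBand.fourierSmooth_toL2]
  have hR := h.eq_smul h.reflectSmooth h1
  have hR1 : ∀ t, (ψ : ℝ → ℂ) (-t) = (ψ : ℝ → ℂ) (-1) / (ψ : ℝ → ℂ) 1 * (ψ : ℝ → ℂ) t := fun t =>
    congrFun (congrArg Subtype.val hR) t
  have hR2 : reflection (toL2 ψ) = ((ψ : ℝ → ℂ) (-1) / (ψ : ℝ → ℂ) 1) • toL2 ψ := by
    rw [reflection_toL2, hR, map_smul]
    rfl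
  have hint : ∀ ξ : ℝ, (Complex.exp (Complex.I * c * (1 - ξ)) • ContinuousLinearMap.id ℂ L2
        + Complex.exp (-(Complex.I * c * (1 - ξ))) • reflection) (heunMultiplier ψ ξ • toL2 ψ)
      = ((Complex.exp (Complex.I * c * (1 - ξ)) * (ψ : ℝ → ℂ) (1 - ξ)
        + Complex.exp (-(Complex.I * c * (1 - ξ))) * (ψ : ℝ → ℂ) (-(1 - ξ)))
          / (ψ : ℝ → ℂ) 1) • toL2 ψ := by
    intro ξ
    rw [hR1]
    simp only [add_apply, smul_apply, ContinuousLinearMap.id_apply, map_smul, hR2,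
      smul_smul, ← add_smul, heunMultiplier]
    congr 1
    ring
  simp only [hint]
  rw [intervalIntegral.integral_smul_const, intervalIntegral.integral_div,
    ← fourierFun_one_eq c (continuous_smooth ψ), hF]

end TimeBand

open TimeBand

theorem mainTheorem4 (c : ℝ) (hc : 0 < c) :
    ∃ V : ℝ → (TimeBand.L2 →L[ℂ] TimeBand.L2),
      (∀ ξ ∈ Set.Icc (0 : ℝ) 1,
        (TimeBand.heunU c ξ).IsClosable ∧
        (TimeBand.heunU c ξ).closure = (V ξ : TimeBand.L2 →ₗ[ℂ] TimeBand.L2).toPMap ⊤) ∧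
      ∀ f : TimeBand.L2,
        IntervalIntegrable (fun ξ : ℝ =>
          (Complex.exp (Complex.I * c * (1 - ξ)) • ContinuousLinearMap.id ℂ TimeBand.L2
            + Complex.exp (-(Complex.I * c * (1 - ξ))) • TimeBand.reflection) (V ξ f))
          MeasureTheory.volume 0 1 ∧
        TimeBand.finiteFourier c f = ∫ ξ in (0 : ℝ)..1,
          (Complex.exp (Complex.I * c * (1 - ξ)) • ContinuousLinearMap.id ℂ TimeBand.L2
            + Complex.exp (-(Complex.I * c * (1 - ξ))) • TimeBand.reflection) (V ξ f) := by
  obtain ⟨ι, b, lam, ψ, hb⟩ := exists_hilbertBasis_heunEigenfunctions hc.ne'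
  set C := Real.exp (2 * c ^ 2 + 1)
  have hC0 : 0 ≤ C := (Real.exp_pos _).le
  have hex : ∀ ξ : ℝ, ∃ V : L2 →L[ℂ] L2, ξ ∈ Icc (0 : ℝ) 1 →
      ‖V‖ ≤ C ∧ ∀ f i, inner ℂ (b i) (V f) = heunMultiplier (ψ i) ξ * inner ℂ (b i) f := by
    intro ξ
    by_cases hξ : ξ ∈ Icc (0 : ℝ) 1
    · obtain ⟨V, hV⟩ := exists_diagonal_operator b hC0 (m := fun i => heunMultiplier (ψ i) ξ)
        fun i => (hb i).1.norm_heunMultiplier_le hc.ne' (hb i).2.1 hξ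
      exact ⟨V, fun _ => hV⟩
    · exact ⟨0, fun h => absurd h hξ⟩
  choose V hV using hex
  have hVb : ∀ ξ ∈ Icc (0 : ℝ) 1, ∀ i, V ξ (b i) = heunMultiplier (ψ i) ξ • b i := fun ξ hξ i =>
    apply_eq_smul_of_inner b (m := fun i => heunMultiplier (ψ i) ξ) (hV ξ hξ).2 i
  refine ⟨V, fun ξ hξ => ?_, ?_⟩
  · refine isClosable_and_closure_eq (fun p hp => b.ext_inner fun i => ?_) b.dense_span ?_
    · rw [heunU_graph] at hp
      rw [(hV ξ hξ).2, (hb i).2.2, (hb i).1.inner_of_mem_heunUGraph (hb i).2.1 hp]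
    · rintro _ ⟨i, rfl⟩
      rw [heunU_graph, hVb ξ hξ, (hb i).2.2]
      exact (hb i).1.mem_heunUGraph (hb i).2.1 ξ
  have hcont : ∀ f, ContinuousOn (fun ξ => V ξ f) (Icc 0 1) := by
    refine continuousOn_apply_of_basis b (fun ξ hξ => (hV ξ hξ).1) fun i => ?_
    refine ContinuousOn.congr (f := fun ξ => heunMultiplier (ψ i) ξ • b i) ?_
      fun ξ hξ => hVb ξ hξ i
    have := continuous_smooth (ψ i)
    exact (((this.comp (continuous_const.sub continuous_id)).div_const _).smul
      continuous_const).continuousOn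
  let B : ℝ → L2 →L[ℂ] L2 := fun ξ =>
    Complex.exp (Complex.I * c * (1 - ξ)) • ContinuousLinearMap.id ℂ L2
      + Complex.exp (-(Complex.I * c * (1 - ξ))) • reflection
  have hB : Continuous B := by fun_prop
  have hBint : ∀ f, IntervalIntegrable (fun ξ => B ξ (V ξ f)) volume 0 1 := by
    intro f
    refine ContinuousOn.intervalIntegrable ?_
    rw [uIcc_of_le zero_le_one]
    exact hB.continuousOn.clm_apply (hcont f)
  -- Both sides of the formula are bounded operators, so it suffices to compare them on the basis.
  obtain ⟨K, hK⟩ := (isCompact_Icc (a := (0 : ℝ)) (b := 1)).exists_bound_of_continuousOn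
    hB.continuousOn
  let I : L2 →L[ℂ] L2 := LinearMap.mkContinuous
    { toFun := fun f => ∫ ξ in (0 : ℝ)..1, B ξ (V ξ f)
      map_add' := fun f g => by
        simp only [map_add]
        exact intervalIntegral.integral_add (hBint f) (hBint g)
      map_smul' := fun a f => by
        simp only [map_smul]
        exact intervalIntegral.integral_smul a _ } (K * C) fun f => by
    have h := intervalIntegral.norm_integral_le_of_norm_le_const (a := 0) (b := 1)
      (f := fun ξ => B ξ (V ξ f)) (C := K * (C * ‖f‖)) fun ξ hξ => by
        rw [uIoc_of_le zero_le_one] at hξ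
        have hξ' : ξ ∈ Icc (0 : ℝ) 1 := Ioc_subset_Icc_self hξ
        exact (B ξ).le_of_opNorm_le_of_le (hK ξ hξ')
          ((V ξ).le_of_opNorm_le (hV ξ hξ').1 f)
    simpa [mul_assoc] using h
  have hI : finiteFourierL c = I := by
    refine ContinuousLinearMap.ext_on (s := range b) ?_ ?_
    · rw [Submodule.dense_iff_topologicalClosure_eq_top]
      exact b.dense_span
    · rintro _ ⟨i, rfl⟩
      rw [finiteFourierL_apply]
      change _ = ∫ ξ in (0 : ℝ)..1, B ξ (V ξ (b i))
      rw [(hb i).2.2, (hb i).1.finiteFourier_eq_integral (hb i).2.1]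
      refine intervalIntegral.integral_congr fun ξ hξ => ?_
      rw [uIcc_of_le zero_le_one] at hξ
      simp only [B]
      rw [← (hb i).2.2, hVb ξ hξ]
  exact fun f => ⟨hBint f, congrArg (fun A : L2 →L[ℂ] L2 => A f) hI⟩
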